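/- Consider a two-tier cellular network in the plane with $N\ge 1$ channels under co-channel spectrum allocation. Macro base stations (MBSs) and femto access points (FAPs) are located at the points of independent homogeneous Poisson point processes $\Phi_B$ and $\Phi_F$ in $\mathbb{R}^2$ with densities $\lambda_B>0$ and $\lambda_F>0$, and transmit with powers $P_B>0$ and $P_F>0$; put $\tilde P_F=P_F/P_B$. Let $\alpha>2$ be the path loss exponent and $\delta=2/\alpha$. All links have i.i.d. unit-mean exponential fading coefficients $h_x$. A user at the origin, on a fixed channel, is served by the MBS $x_0\in\Phi_B$ of maximum mean received power $P_B\|x\|^{-\alpha}$. Every other MBS is active on the user's channel with probability $\zeta_{\mathrm C}\in[0,1]$ (the activity factor), and every FAP transmits on exactly one channel, chosen uniformly among the $N$ channels, so that the density of FAPs per channel is $\tilde\lambda_F=\lambda_F/N$. Activities, channel choices and fading coefficients are independent of each other and of $\Phi_B,\Phi_F$. The signal-to-interference ratio of the user is $$\mathrm{SIR}=\frac{h_{x_0}\|x_0\|^{-\alpha}}{\sum_{x}h_x\|x\|^{-\alpha}+\sum_{y}h_y\|y\|^{-\alpha}\tilde P_F},$$ where $x$ runs over the active MBSs in $\Phi_B\setminus\{x_0\}$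 and $y$ over the FAPs in $\Phi_F$ that transmit on the user's channel. Let $R_m$ and $R_d$ be the distances from the origin to the closest and the second closest point of $\Phi_B$, and let $0<R\le 1$; the user is a cell-center user (CCU) if $R_m/R_d\le R$. Then for every threshold $\beta>0$ the coverage probability of a CCU, $\mathcal{C}_{\mathrm{CC}}(\beta)=\mathbb{P}\left(\mathrm{SIR}>\beta\mid R_m/R_d\le R\right)$, is $$\mathcal{C}_{\mathrm{CC}}(\beta)=\left[1+\zeta_{\mathrm C}R^2\,\mathcal{H}(\beta,\delta,R)+\pi\delta R^2\frac{\tilde\lambda_F}{\lambda_B}\left(\beta\tilde P_F\right)^{\delta}\csc(\pi\delta)\right]^{-1},\qquad \mathcal{H}(\beta,\delta,R)=\beta^{\delta}\int_{R^{-2}\beta^{-\delta}}^{\infty}\frac{du}{1+u^{1/\delta}},$$ where the integral converges. For $\delta=\frac12$, $\mathcal{H}(\beta,\tfrac12,R)=\beta^{1/2}\arctan\left(R^2\beta^{1/2}\right)$. -/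

import Mathlib

open MeasureTheory ProbabilityTheory
open scoped ENNReal NNReal

namespace HetNet

/-- The plane `ℝ²` with its Euclidean norm. -/
abbrev Plane : Type := EuclideanSpace ℝ (Fin 2)

/-- Number of points (counted with multiplicity) of the configuration `x` in the set `B`. -/
noncomputable def count (x : ℕ → Plane) (B : Set Plane) : ℕ∞ :=
  {n | x n ∈ B}.encard

/-- `X 0, X 1, …` is a measurable enumeration (in no particular order) of a homogeneous Poisson
point process on the plane with density `lam`: the number of points in a Borel set of finite area
is Poisson distributed with mean `lam` times the area, and the numbers of points in
pairwise disjoint Borel sets are independent. -/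
structure IsPoissonProcess {Ω : Type*} [MeasurableSpace Ω] (P : Measure Ω)
    (X : ℕ → Ω → Plane) (lam : ℝ) : Prop where
  measurable : ∀ n, Measurable (X n)
  count_law : ∀ B : Set Plane, MeasurableSet B → volume B ≠ ∞ →
    HasLaw (fun ω => count (fun n => X n ω) B)
      ((poissonMeasure (lam * volume.real B).toNNReal).map (fun j : ℕ => (j : ℕ∞))) P
  count_indep : ∀ (m : ℕ) (B : Fin m → Set Plane), (∀ i, MeasurableSet (B i)) →
    Pairwise (fun i j => Disjoint (B i) (B j)) →
    iIndepFun (fun i ω => count (fun n => X n ω) (B i)) P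

/-- Labels of the sources of randomness of the two-tier network. -/
inductive Source : Type
  | mbsLocations
  | fapLocations
  | mbsFading (n : ℕ)
  | fapFading (n : ℕ)
  | mbsActivity (n : ℕ)
  | fapChannel (n : ℕ)

/-- The space in which each source of randomness takes its values (`N` is the number of
channels). -/
def Source.Val (N : ℕ) : Source → Type
  | .mbsLocations => ℕ → Plane
  | .fapLocations => ℕ → Plane
  | .mbsFading _ => ℝ
  | .fapFading _ => ℝ
  | .mbsActivity _ => Bool
  | .fapChannel _ => Fin N

instance Source.instMeasurableSpaceVal (N : ℕ) : (s : Source) → MeasurableSpace (s.Val N)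
  | .mbsLocations => inferInstanceAs (MeasurableSpace (ℕ → Plane))
  | .fapLocations => inferInstanceAs (MeasurableSpace (ℕ → Plane))
  | .mbsFading _ => inferInstanceAs (MeasurableSpace ℝ)
  | .fapFading _ => inferInstanceAs (MeasurableSpace ℝ)
  | .mbsActivity _ => inferInstanceAs (MeasurableSpace Bool)
  | .fapChannel _ => inferInstanceAs (MeasurableSpace (Fin N))

/-- The random elements of a two-tier network with `N` channels on the sample space `Ω`. -/
structure Network (Ω : Type*) (N : ℕ) where
  /-- location of the `n`-th macro base station (MBS) -/
  mbs : ℕ → Ω → Plane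
  /-- location of the `n`-th femto access point (FAP) -/
  fap : ℕ → Ω → Plane
  /-- fading coefficient from the `n`-th MBS to the user -/
  mbsFading : ℕ → Ω → ℝ
  /-- fading coefficient from the `n`-th FAP to the user -/
  fapFading : ℕ → Ω → ℝ
  /-- whether the `n`-th MBS, if it is not the serving one, transmits on the channel of the user -/
  mbsActive : ℕ → Ω → Bool
  /-- the channel on which the `n`-th FAP transmits -/
  fapChannel : ℕ → Ω → Fin N

namespace Network

variable {Ω : Type*} {N : ℕ}

/-- The random element attached to each source of randomness. -/
def element (net : Network Ω N) : (s : Source) → Ω → s.Val N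
  | .mbsLocations => fun ω n => net.mbs n ω
  | .fapLocations => fun ω n => net.fap n ω
  | .mbsFading n => net.mbsFading n
  | .fapFading n => net.fapFading n
  | .mbsActivity n => net.mbsActive n
  | .fapChannel n => net.fapChannel n

/-- The probabilistic model under co-channel spectrum allocation: MBSs and FAPs form Poisson
processes with densities `lamB` and `lamF`; the fading coefficients are exponential with mean one;
each MBS is active on the channel of the user with probability `zeta`; each FAP uses
one of all `N` channels, chosen uniformly; all these random elements are independent. -/
structure IsCoChannel [MeasurableSpace Ω] (net : Network Ω N) (P : Measure Ω)
    (lamB lamF zeta : ℝ) : Prop where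
  mbs_poisson : IsPoissonProcess P net.mbs lamB
  fap_poisson : IsPoissonProcess P net.fap lamF
  mbsFading_measurable : ∀ n, Measurable (net.mbsFading n)
  fapFading_measurable : ∀ n, Measurable (net.fapFading n)
  mbsActive_measurable : ∀ n, Measurable (net.mbsActive n)
  fapChannel_measurable : ∀ n, Measurable (net.fapChannel n)
  mbsFading_law : ∀ n, HasLaw (net.mbsFading n) (expMeasure 1) P
  fapFading_law : ∀ n, HasLaw (net.fapFading n) (expMeasure 1) P
  mbsActive_law : ∀ n, P {ω | net.mbsActive n ω = true} = ENNReal.ofReal zeta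
  fapChannel_law : ∀ n (c : Fin N), P {ω | net.fapChannel n ω = c} = (N : ℝ≥0∞)⁻¹
  indep : iIndepFun net.element P

/-- Distance from the user, who is at the origin, to the `j`-th closest MBS (`j = 1, 2, …`). -/
noncomputable def mbsDistance (net : Network Ω N) (j : ℕ) (ω : Ω) : ℝ :=
  sInf {r : ℝ | (j : ℕ∞) ≤ count (fun n => net.mbs n ω) (Metric.closedBall 0 r)}

/-- The event that the user is a cell-center user: the ratio of the distances to the closest and
to the second closest MBS is at most `R`. -/
def cellCenter (net : Network Ω N) (R : ℝ) : Set Ω :=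
  {ω | net.mbsDistance 1 ω / net.mbsDistance 2 ω ≤ R}

/-- The `n`-th MBS has the maximum mean received power at the user, so that it is the serving
MBS (almost surely there is exactly one). -/
def IsServing (net : Network Ω N) (PB α : ℝ) (n : ℕ) (ω : Ω) : Prop :=
  ∀ m, ENNReal.ofReal PB * ‖net.mbs m ω‖ₑ ^ (-α) ≤ ENNReal.ofReal PB * ‖net.mbs n ω‖ₑ ^ (-α)

/-- Interference at the user, served by MBS `n`, from the other MBSs that are active on the channel
of the user; powers are relative to the transmission power of the MBSs. -/
noncomputable def mbsInterference (net : Network Ω N) (α : ℝ) (n : ℕ) (ω : Ω) : ℝ≥0∞ :=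
  ∑' m, if m ≠ n ∧ net.mbsActive m ω = true then
    ENNReal.ofReal (net.mbsFading m ω) * ‖net.mbs m ω‖ₑ ^ (-α) else 0

/-- Interference at the user from the FAPs that transmit on channel `c`, with relative
transmission power `PF / PB`. -/
noncomputable def fapInterference (net : Network Ω N) (PB PF α : ℝ) (c : Fin N) (ω : Ω) : ℝ≥0∞ :=
  ∑' m, if net.fapChannel m ω = c then
    ENNReal.ofReal (net.fapFading m ω) * ‖net.fap m ω‖ₑ ^ (-α) * ENNReal.ofReal (PF / PB) else 0

/-- Signal-to-interference ratio of a user on channel `c` that is served by MBS `n`. -/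
noncomputable def sir (net : Network Ω N) (PB PF α : ℝ) (c : Fin N) (n : ℕ) (ω : Ω) : ℝ≥0∞ :=
  ENNReal.ofReal (net.mbsFading n ω) * ‖net.mbs n ω‖ₑ ^ (-α) /
    (net.mbsInterference α n ω + net.fapInterference PB PF α c ω)

/-- The event that the user on channel `c` is covered: the signal-to-interference ratio from the
serving MBS exceeds the threshold `β`. -/
def covered (net : Network Ω N) (PB PF α β : ℝ) (c : Fin N) : Set Ω :=
  {ω | ∃ n, net.IsServing PB α n ω ∧ ENNReal.ofReal β < net.sir PB PF α c n ω}

/-- Coverage probability of a cell-center user on channel `c`. -/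
noncomputable def ccuCoverage [MeasurableSpace Ω] (net : Network Ω N) (P : Measure Ω)
    (PB PF α R β : ℝ) (c : Fin N) : ℝ :=
  (ProbabilityTheory.cond P (net.cellCenter R)).real (net.covered PB PF α β c)

end Network

/-- `H(β, δ, R) = β^δ ∫_{R⁻² β^{-δ}}^∞ du / (1 + u^{1/δ})`. -/
noncomputable def H (β δ R : ℝ) : ℝ :=
  β ^ δ * ∫ u in Set.Ioi (R ^ (-2 : ℤ) * β ^ (-δ)), 1 / (1 + u ^ (1 / δ))

end HetNet

/-! Let `t` be the distance to the serving MBS. The user is a CCU exactly when every other MBS lies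
at distance at least `t / R`, so the event is an exclusion disc around the origin. Coverage means
that the exponential fading of the serving link exceeds `load`, the interference multiplied by `β t
^ α`. Given all the rest, this has probability `exp (-load)`, a product over the interferers, and
averaging each mark replaces its factor by `thinLaplace`. With the convention `exp (-∞) = 0` the
exclusion disc is one more factor of the same kind; both are encoded in `linkExponent`.

The FAP locations are then averaged with the Laplace functional of a Poisson process
(`IsPoissonProcess.lintegral_mul_negExp_tsum`). By scaling, the exponent is proportional to `t ^ 2`:
the result is `exp (-γ t ^ 2)` with `γ = lamF * fapRate`. What remains is the mean of a sum over the
MBSs of a multiplicative functional of the other MBSs. The Mecke formula predicts `lamB ∫ exp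
(-(lamB K + γ) ‖x‖ ^ 2) dx = (K / π + γ / (π lamB))⁻¹` with `K = π (R⁻² + zeta H)`. This is
`IsPoissonProcess.lintegral_tsum_palmTerm`, derived from the Laplace functional by cutting the plane
into thin annuli.

The same formula without interference gives `P(CCU) = R ^ 2`, and for `R = 1` the almost sure
uniqueness of the closest MBS. The coverage probability is the quotient of the two values; the FAP
integral is evaluated by Euler's reflection formula. -/

namespace HetNet

/-! ### Exponential and logarithm on `[0, ∞]`. -/

section NegExp
open Filter Topology

/-- The function `x ↦ exp (-x)` on `[0, ∞]`, with `exp (-∞) = 0`. -/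
noncomputable def negExp (x : ℝ≥0∞) : ℝ≥0∞ := EReal.exp (-(x : EReal))

@[simp] lemma negExp_zero : negExp 0 = 1 := by simp [negExp]

@[simp] lemma negExp_top : negExp ∞ = 0 := by simp [negExp]

lemma negExp_ofReal {x : ℝ} (hx : 0 ≤ x) :
    negExp (ENNReal.ofReal x) = ENNReal.ofReal (Real.exp (-x)) := by
  simp only [negExp, EReal.coe_ennreal_ofReal, max_eq_left hx]
  rw [← EReal.coe_neg, EReal.exp_coe]

lemma negExp_add (x y : ℝ≥0∞) : negExp (x + y) = negExp x * negExp y := by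
  rw [negExp, negExp, negExp, EReal.coe_ennreal_add, ← EReal.exp_add, EReal.neg_add, sub_eq_add_neg]
  · exact Or.inl (EReal.coe_ennreal_ne_bot x)
  · exact Or.inr (EReal.coe_ennreal_ne_bot y)

lemma negExp_antitone : Antitone negExp := fun _ _ h =>
  EReal.exp_monotone (EReal.neg_le_neg_iff.2 (EReal.coe_ennreal_le_coe_ennreal_iff.2 h))

lemma negExp_le_one (x : ℝ≥0∞) : negExp x ≤ 1 := by
  simpa using negExp_antitone (bot_le : ⊥ ≤ x)

lemma negExp_ne_top (x : ℝ≥0∞) : negExp x ≠ ∞ := ((negExp_le_one x).trans_lt ENNReal.one_lt_top).ne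

lemma continuous_negExp : Continuous negExp :=
  ENNReal.continuous_exp.comp (continuous_neg.comp continuous_coe_ennreal_ereal)

@[fun_prop] lemma measurable_negExp : Measurable negExp := continuous_negExp.measurable

lemma negExp_sum {ι : Type*} (s : Finset ι) (f : ι → ℝ≥0∞) :
    negExp (∑ i ∈ s, f i) = ∏ i ∈ s, negExp (f i) := by
  classical
  induction s using Finset.induction_on with
  | empty => simp
  | insert a s ha ih => rw [Finset.sum_insert ha, Finset.prod_insert ha, negExp_add, ih]

lemma negExp_nat_mul (n : ℕ) (x : ℝ≥0∞) : negExp (n * x) = negExp x ^ n := by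
  simpa using negExp_sum (Finset.range n) (fun _ => x)

/-- The function `x ↦ - log x` on `[0, 1]`. -/
noncomputable def negLog (x : ℝ≥0∞) : ℝ≥0∞ := (-(ENNReal.log x)).toENNReal

/-- Lets a product of Laplace transforms be written as `negExp` of a sum over points, the shape that
the Laplace functional handles. -/
lemma negExp_negLog {x : ℝ≥0∞} (hx : x ≤ 1) : negExp (negLog x) = x := by
  have : 0 ≤ -(ENNReal.log x) := by
    rw [EReal.le_neg, neg_zero]; exact ENNReal.log_le_zero_iff.2 hx
  rw [negExp, negLog, EReal.coe_toENNReal this, neg_neg, ENNReal.exp_log]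

@[simp] lemma negLog_one : negLog 1 = 0 := by simp [negLog]

lemma negLog_antitone : Antitone negLog := fun _ _ h =>
  EReal.toENNReal_le_toENNReal (EReal.neg_le_neg_iff.2 (ENNReal.log_monotone h))

@[fun_prop] lemma measurable_negLog : Measurable negLog :=
  measurable_ereal_toENNReal.comp (continuous_neg.measurable.comp ENNReal.measurable_log)

end NegExp

/-! ### The unit exponential law. -/

/-- Survival function of the exponential distribution. -/
lemma expMeasure_survival (s : ℝ≥0∞) :
    expMeasure 1 {x : ℝ | s < ENNReal.ofReal x} = negExp s := by
  have := isProbabilityMeasure_expMeasure (r := 1) one_pos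
  induction s with
  | top => simp
  | coe s =>
    have h : {x : ℝ | (s : ℝ≥0∞) < ENNReal.ofReal x} = (Set.Iic (s : ℝ))ᶜ := by
      ext x
      simp only [Set.mem_ofPred_eq, Set.mem_compl_iff, Set.mem_Iic, not_le]
      rw [← ENNReal.ofReal_coe_nnreal, ENNReal.ofReal_lt_ofReal_iff']
      have := s.coe_nonneg
      exact ⟨fun h => h.1, fun h => ⟨h, lt_of_le_of_lt this h⟩⟩
    rw [h, prob_compl_eq_one_sub measurableSet_Iic, ← ENNReal.ofReal_coe_nnreal,
      negExp_ofReal s.coe_nonneg, ← ProbabilityTheory.ofReal_cdf, cdf_expMeasure_eq one_pos]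
    rw [if_pos s.coe_nonneg, ← ENNReal.ofReal_one, ← ENNReal.ofReal_sub]
    · congr 1; simp
    · have : Real.exp (-(1 * (s:ℝ))) ≤ 1 := by simp
      linarith

lemma expMeasure_Iic_zero : expMeasure 1 (Set.Iic (0 : ℝ)) = 0 := by
  have := isProbabilityMeasure_expMeasure (r := 1) one_pos
  rw [← ProbabilityTheory.ofReal_cdf, cdf_expMeasure_eq one_pos]
  simp

/-- Laplace transform of the exponential distribution. -/
lemma lintegral_negExp_expMeasure (a : ℝ≥0∞) :
    ∫⁻ x : ℝ, negExp (ENNReal.ofReal x * a) ∂(expMeasure 1) = (1 + a)⁻¹ := by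
  have hp := isProbabilityMeasure_expMeasure (r := 1) one_pos
  have hpos : ∀ᵐ x ∂(expMeasure 1), 0 < x := by
    rw [ae_iff]; simpa [not_lt, ← Set.Iic_def] using expMeasure_Iic_zero
  induction a with
  | top =>
    rw [lintegral_congr_ae (g := fun _ => 0)]
    · simp
    · filter_upwards [hpos] with x hx
      rw [ENNReal.mul_top (by simpa using hx), negExp_top]
  | coe a =>
    have hd : expMeasure 1 = (volume : Measure ℝ).withDensity (exponentialPDF 1) := rfl
    have hm : ∀ r, Measurable (exponentialPDF r) := fun r =>
      (measurable_exponentialPDFReal r).ennreal_ofReal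
    rw [hd, lintegral_withDensity_eq_lintegral_mul _ (hm 1) (by fun_prop)]
    have ha : (0 : ℝ) < 1 + a := by have := a.coe_nonneg; linarith
    calc _ = ∫⁻ x, ENNReal.ofReal (1 + a : ℝ)⁻¹ * exponentialPDF (1 + a) x := by
          refine lintegral_congr fun x => ?_
          simp only [Pi.mul_apply, exponentialPDF_eq]
          split_ifs with hx
          · rw [← ENNReal.ofReal_coe_nnreal, ← ENNReal.ofReal_mul hx,
              negExp_ofReal (mul_nonneg hx a.coe_nonneg), ← ENNReal.ofReal_mul (by positivity),
              ← ENNReal.ofReal_mul (by positivity), ← mul_assoc, inv_mul_cancel₀ ha.ne',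
              one_mul, one_mul, ← Real.exp_add]
            congr 2; ring_nf
          · simp
      _ = _ := by
          rw [lintegral_const_mul _ (hm _),
            lintegral_exponentialPDF_eq_one ha, mul_one, ENNReal.ofReal_inv_of_pos ha,
            ENNReal.ofReal_add zero_le_one a.coe_nonneg]
          simp

/-! ### Generating function and mean of the Poisson law. -/

section Poisson

/-- Generating function of the Poisson distribution. -/
lemma lintegral_negExp_poissonMeasure (r : ℝ≥0) (x : ℝ≥0∞) :
    ∫⁻ n : ℕ, negExp (x * n) ∂(poissonMeasure r) = negExp (r * (1 - negExp x)) := by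
  obtain ⟨q, hq⟩ : ∃ q : ℝ≥0, negExp x = q := ⟨_, (ENNReal.coe_toNNReal (negExp_ne_top x)).symm⟩
  have hq1 : q ≤ 1 := by have := negExp_le_one x; rw [hq] at this; exact_mod_cast this
  rw [lintegral_countable']
  simp_rw [mul_comm x, negExp_nat_mul, hq, poissonMeasure_singleton]
  have h2 : (r : ℝ≥0∞) * (1 - q) = ENNReal.ofReal (r * (1 - q)) := by
    rw [ENNReal.ofReal_mul r.coe_nonneg, ENNReal.ofReal_sub _ q.coe_nonneg]; simp
  have h3 : (0:ℝ) ≤ r * (1 - q) := mul_nonneg r.coe_nonneg (sub_nonneg.2 (by exact_mod_cast hq1))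
  rw [h2, negExp_ofReal h3]
  have hs := (NormedSpace.expSeries_div_hasSum_exp ((r * q : ℝ))).mul_left (Real.exp (-r))
  rw [← Real.exp_eq_exp_ℝ, ← Real.exp_add] at hs
  have h4 : (-(r : ℝ) + r * q) = -(r * (1 - q)) := by ring
  rw [h4] at hs
  rw [← hs.tsum_eq, ENNReal.ofReal_tsum_of_nonneg (fun n => by positivity) hs.summable]
  refine tsum_congr fun n => ?_
  rw [← ENNReal.ofReal_coe_nnreal (p := q), ← ENNReal.ofReal_pow q.coe_nonneg,
    ← ENNReal.ofReal_mul (by positivity)]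
  congr 1
  rw [mul_pow]; ring

lemma lintegral_poissonMeasure (r : ℝ≥0) :
    ∫⁻ n : ℕ, (n : ℝ≥0∞) ∂(poissonMeasure r) = r := by
  rw [lintegral_countable']
  simp_rw [poissonMeasure_singleton]
  -- The term `n = 0` vanishes; after the shift, `(n + 1) / (n + 1)! = 1 / n!` leaves `r` times the
  -- exponential series.
  rw [tsum_eq_zero_add' ENNReal.summable]
  have hs := ((NormedSpace.expSeries_div_hasSum_exp (r : ℝ)).mul_left (Real.exp (-r))).mul_left
    (r : ℝ)
  rw [← Real.exp_eq_exp_ℝ, ← Real.exp_add, neg_add_cancel, Real.exp_zero, mul_one] at hs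
  have : (r : ℝ≥0∞) = ENNReal.ofReal r := by simp
  rw [this]
  conv_rhs => rw [← hs.tsum_eq]
  rw [ENNReal.ofReal_tsum_of_nonneg (fun n => by positivity) hs.summable]
  simp only [Nat.cast_zero, zero_mul, zero_add]
  refine tsum_congr fun n => ?_
  rw [← ENNReal.ofReal_natCast, ← ENNReal.ofReal_mul (by positivity)]
  congr 1
  rw [Nat.factorial_succ]
  push_cast
  field_simp
  exact pow_succ' _ _

end Poisson


/-! ### Laplace functional of a Poisson process. -/

section Laplace
open Filter Topology

lemma measurableEmbedding_toENNReal : MeasurableEmbedding ENat.toENNReal :=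
  ⟨ENat.toENNReal_strictMono.injective, .of_discrete,
    fun {t} _ => (t.to_countable.image _).measurableSet⟩

lemma tsum_indicator_eq_count (x : ℕ → Plane) (B : Set Plane) :
    ∑' n, B.indicator (fun _ => (1 : ℝ≥0∞)) (x n) = (count x B : ℝ≥0∞) := by
  rw [count, ← ENNReal.tsum_set_one, tsum_subtype {n | x n ∈ B} (fun _ => (1 : ℝ≥0∞))]
  rfl

variable {Ω : Type*} [MeasurableSpace Ω] {P : Measure Ω} {X : ℕ → Ω → Plane} {lam : ℝ}

lemma IsPoissonProcess.measurable_count (hX : IsPoissonProcess P X lam) {B : Set Plane}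
    (hB : MeasurableSet B) :
    Measurable (fun ω => (count (fun n => X n ω) B : ℝ≥0∞)) := by
  simp_rw [← tsum_indicator_eq_count]
  exact Measurable.tsum fun n => (measurable_const.indicator hB).comp (hX.measurable n)

lemma IsPoissonProcess.lintegral_comp_count (hX : IsPoissonProcess P X lam) {B : Set Plane}
    (hB : MeasurableSet B) (hB' : volume B ≠ ∞) (g : ℕ∞ → ℝ≥0∞) :
    ∫⁻ ω, g (count (fun n => X n ω) B) ∂P =
      ∫⁻ j : ℕ, g j ∂(poissonMeasure (lam * volume.real B).toNNReal) := by
  rw [(hX.count_law B hB hB').lintegral_comp (Measurable.of_discrete).aemeasurable,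
    lintegral_map .of_discrete .of_discrete]

lemma coe_toNNReal_mul_measureReal (hlam : 0 ≤ lam) {B : Set Plane} (hB : volume B ≠ ∞) :
    ((lam * volume.real B).toNNReal : ℝ≥0∞) = ENNReal.ofReal lam * volume B := by
  change ENNReal.ofReal _ = _
  rw [ENNReal.ofReal_mul hlam, ofReal_measureReal hB]

lemma IsPoissonProcess.lintegral_count (hX : IsPoissonProcess P X lam) (hlam : 0 ≤ lam)
    {B : Set Plane} (hB : MeasurableSet B) (hB' : volume B ≠ ∞) :
    ∫⁻ ω, (count (fun n => X n ω) B : ℝ≥0∞) ∂P = ENNReal.ofReal lam * volume B := by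
  rw [hX.lintegral_comp_count hB hB' (fun j => (j : ℝ≥0∞)), ← coe_toNNReal_mul_measureReal hlam hB',
    ← lintegral_poissonMeasure]
  simp

lemma IsPoissonProcess.lintegral_negExp_count (hX : IsPoissonProcess P X lam) (hlam : 0 ≤ lam)
    {B : Set Plane} (hB : MeasurableSet B) (hB' : volume B ≠ ∞) (c : ℝ≥0∞) :
    ∫⁻ ω, negExp (c * (count (fun n => X n ω) B : ℝ≥0∞)) ∂P =
      negExp (ENNReal.ofReal lam * ((1 - negExp c) * volume B)) := by
  rw [hX.lintegral_comp_count hB hB' (fun j => negExp (c * (j : ℝ≥0∞)))]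
  simp only [ENat.toENNReal_coe]
  rw [lintegral_negExp_poissonMeasure, coe_toNNReal_mul_measureReal hlam hB', mul_assoc,
    mul_comm (volume B)]

lemma IsPoissonProcess.iIndepFun_count {ι : Type*} [Finite ι] (hX : IsPoissonProcess P X lam)
    {B : ι → Set Plane} (hB : ∀ i, MeasurableSet (B i))
    (hd : Pairwise (fun i j => Disjoint (B i) (B j))) :
    iIndepFun (fun i ω => count (fun n => X n ω) (B i)) P := by
  cases nonempty_fintype ι
  let e := Fintype.equivFin ι
  have := hX.count_indep _ (fun k => B (e.symm k)) (fun k => hB _)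
    (fun i j hij => hd (fun h => hij (e.symm.injective h)))
  simpa using this.precomp e.injective

/-- Used twice: with `g = id` it turns a sum over points into weighted counts of the level sets, and
with `g c = 1 - negExp c` it splits the integral in the exponent in the same way. -/
lemma simpleFunc_apply_eq_sum (f : SimpleFunc Plane ℝ≥0∞) (g : ℝ≥0∞ → ℝ≥0∞) (hg : g 0 = 0)
    (y : Plane) :
    g (f y) = ∑ c : {c // c ∈ f.range.filter (· ≠ 0)},
      g c * (f ⁻¹' {(c : ℝ≥0∞)}).indicator (fun _ => 1) y := by
  rw [Finset.sum_coe_sort (f.range.filter (· ≠ 0))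
    (fun c => g c * (f ⁻¹' {c}).indicator (fun _ => 1) y)]
  rw [Finset.sum_eq_single (f y)]
  · simp
  · intro c _ hc
    rw [Set.indicator_of_notMem, mul_zero]
    exact fun h => hc h.symm
  · intro h
    have : f y = 0 := by simpa using h
    simp [this, hg]

/-- The nonzero level sets of `f` and the set `A` are pairwise disjoint, so their counts are
independent. The expectation factors, and each level set contributes the generating function of a
Poisson variable. -/
lemma IsPoissonProcess.lintegral_mul_negExp_tsum_simpleFunc (hX : IsPoissonProcess P X lam)
    (hlam : 0 ≤ lam) (f : SimpleFunc Plane ℝ≥0∞) (hf : volume (Function.support f) ≠ ∞)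
    {A : Set Plane} (hA : MeasurableSet A) (hfA : ∀ y ∈ A, f y = 0) (F : ℕ∞ → ℝ≥0∞) :
    ∫⁻ ω, F (count (fun n => X n ω) A) * negExp (∑' n, f (X n ω)) ∂P =
      (∫⁻ ω, F (count (fun n => X n ω) A) ∂P) *
        negExp (ENNReal.ofReal lam * ∫⁻ y, (1 - negExp (f y))) := by
  classical
  let s := f.range.filter (· ≠ 0)
  have hms : ∀ c : ℝ≥0∞, MeasurableSet (f ⁻¹' {c}) := fun c => f.measurableSet_preimage _
  have hfin : ∀ c : s, volume (f ⁻¹' {(c : ℝ≥0∞)}) ≠ ∞ := fun c =>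
    ((measure_mono fun y hy => by
      have h1 : f y = c := hy
      have h2 := (Finset.mem_filter.1 c.2).2
      rw [Function.mem_support, h1]; exact h2).trans_lt hf.lt_top).ne
  -- The index `none` stands for `A`, and `some c` for the level set of the value `c`.
  let B : Option s → Set Plane := fun o => o.elim A (fun c => f ⁻¹' {(c : ℝ≥0∞)})
  have hind : iIndepFun (fun o ω => count (fun n => X n ω) (B o)) P := by
    refine hX.iIndepFun_count (fun o => ?_) ?_
    · cases o with
      | none => exact hA
      | some c => exact hms c
    · have key : ∀ c : s, Disjoint A (f ⁻¹' {(c : ℝ≥0∞)}) := fun c =>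
        Set.disjoint_left.2 fun y hy hy' => (Finset.mem_filter.1 c.2).2
          ((show f y = c from hy').symm.trans (hfA y hy))
      intro i j hij
      cases i with
      | none =>
        cases j with
        | none => exact absurd rfl hij
        | some c => exact key c
      | some c =>
        cases j with
        | none => exact (key c).symm
        | some d =>
          refine Set.disjoint_left.2 fun y hy hy' => hij ?_
          have h1 : f y = c := hy
          have h2 : f y = d := hy'
          rw [Subtype.ext (h1.symm.trans h2)]
  let g : Option s → ℕ∞ → ℝ≥0∞ := fun o => o.elim F (fun c j => negExp ((c : ℝ≥0∞) * (j : ℝ≥0∞)))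
  have hind' := hind.comp g (fun _ => .of_discrete)
  have hcm : ∀ o, Measurable (fun ω => count (fun n => X n ω) (B o)) := by
    intro o
    refine measurableEmbedding_toENNReal.measurable_comp_iff.1 (hX.measurable_count ?_)
    cases o with
    | none => exact hA
    | some c => exact hms c
  have h1 := lintegral_prod_eq_prod_lintegral_of_indepFun Finset.univ _ hind'
    (fun o => (Measurable.of_discrete).comp (hcm o))
  simp only [Fintype.prod_option, Function.comp] at h1
  have h2 : ∀ ω, negExp (∑' n, f (X n ω)) =
      ∏ c : s, g (some c) (count (fun n => X n ω) (B (some c))) := by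
    intro ω
    simp only [g, Option.elim]
    rw [← negExp_sum]
    congr 1
    rw [tsum_congr (f := fun n => f (X n ω)) fun n => simpleFunc_apply_eq_sum f id rfl (X n ω),
      Summable.tsum_finsetSum fun _ _ => ENNReal.summable]
    refine Finset.sum_congr rfl fun c _ => ?_
    rw [ENNReal.tsum_mul_left, tsum_indicator_eq_count]
    rfl
  simp_rw [h2]
  refine h1.trans ?_
  congr 1
  rw [lintegral_congr fun y => simpleFunc_apply_eq_sum f (fun c => 1 - negExp c) (by simp) y,
    lintegral_finsetSum (f := fun (c : s) y => (1 - negExp (c : ℝ≥0∞)) *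
      (f ⁻¹' {(c : ℝ≥0∞)}).indicator (fun _ => 1) y) _
      (fun c _ => (measurable_const.indicator (hms c)).const_mul _),
    Finset.mul_sum, negExp_sum]
  refine Finset.prod_congr rfl fun c _ => ?_
  simp only [g, B, Option.elim]
  rw [hX.lintegral_negExp_count hlam (hms c) (hfin c), lintegral_const_mul _
    (measurable_const.indicator (hms c)), lintegral_indicator (hms c)]
  simp

/-- Laplace functional of a Poisson process, joint with the number of points in a set where the
test function vanishes. -/
theorem IsPoissonProcess.lintegral_mul_negExp_tsum [IsProbabilityMeasure P]
    (hX : IsPoissonProcess P X lam)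
    (hlam : 0 ≤ lam) {φ : Plane → ℝ≥0∞} (hφ : Measurable φ)
    {A : Set Plane} (hA : MeasurableSet A) (hφA : ∀ y ∈ A, φ y = 0) {F : ℕ∞ → ℝ≥0∞}
    (hF : ∫⁻ ω, F (count (fun n => X n ω) A) ∂P ≠ ∞) :
    ∫⁻ ω, F (count (fun n => X n ω) A) * negExp (∑' n, φ (X n ω)) ∂P =
      (∫⁻ ω, F (count (fun n => X n ω) A) ∂P) *
        negExp (ENNReal.ofReal lam * ∫⁻ y, (1 - negExp (φ y))) := by
  -- The restriction to balls gives the level sets finite area, as the Poisson law of the counts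
  -- requires.
  let f : ℕ → SimpleFunc Plane ℝ≥0∞ := fun k =>
    (SimpleFunc.eapprox φ k).restrict (Metric.ball 0 k)
  have hf : ∀ k y, f k y = (Metric.ball (0 : Plane) k).indicator (SimpleFunc.eapprox φ k) y :=
    fun k y => SimpleFunc.restrict_apply _ Metric.isOpen_ball.measurableSet _
  have hmono : ∀ y, Monotone (fun k => f k y) := by
    intro y k l hkl
    simp only [hf]
    refine (Set.indicator_le_indicator_of_subset
      (Metric.ball_subset_ball (Nat.cast_le.2 hkl)) (fun _ => bot_le) y).trans ?_
    exact Set.indicator_le_indicator (SimpleFunc.monotone_eapprox φ hkl y)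
  have hle : ∀ k y, f k y ≤ φ y := by
    intro k y
    rw [hf]
    refine (Set.indicator_le_self _ _ y).trans ?_
    rw [← SimpleFunc.iSup_eapprox_apply hφ y]
    exact le_iSup (fun n => SimpleFunc.eapprox φ n y) k
  have hlim : ∀ y, Tendsto (fun k => f k y) atTop (𝓝 (φ y)) := by
    intro y
    have h1 : Tendsto (fun k => SimpleFunc.eapprox φ k y) atTop (𝓝 (φ y)) := by
      have := tendsto_atTop_iSup (fun k l h => SimpleFunc.monotone_eapprox φ h y)
      rwa [SimpleFunc.iSup_eapprox_apply hφ y] at this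
    refine h1.congr' ?_
    obtain ⟨K, hK⟩ := exists_nat_gt ‖y‖
    filter_upwards [eventually_ge_atTop K] with k hk
    rw [hf, Set.indicator_of_mem]
    rw [mem_ball_zero_iff]
    exact hK.trans_le (by exact_mod_cast hk)
  have hsup : ∀ k, volume (Function.support (f k)) ≠ ∞ := fun k =>
    ((measure_mono (t := Metric.ball (0 : Plane) k) fun y hy => by
      by_contra h
      exact hy (by rw [hf, Set.indicator_of_notMem h])).trans_lt measure_ball_lt_top).ne
  have hcm : Measurable (fun ω => F (count (fun n => X n ω) A)) := by
    exact Measurable.comp .of_discrete (measurableEmbedding_toENNReal.measurable_comp_iff.1 (hX.measurable_count hA))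
  have hk : ∀ k, _ := fun k => hX.lintegral_mul_negExp_tsum_simpleFunc hlam (f k) (hsup k) hA
    (fun y hy => le_antisymm ((hle k y).trans (hφA y hy).le) bot_le) F
  have hmeas : ∀ ψ : Plane → ℝ≥0∞, Measurable ψ → Measurable (fun ω => ∑' n, ψ (X n ω)) :=
    fun ψ hψ => Measurable.tsum fun n => hψ.comp (hX.measurable n)
  refine tendsto_nhds_unique (f := fun k => ∫⁻ ω, F (count (fun n => X n ω) A) *
    negExp (∑' n, f k (X n ω)) ∂P) (l := atTop) ?_ ?_
  · refine tendsto_lintegral_of_dominated_convergence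
      (fun ω => F (count (fun n => X n ω) A)) (fun k => ?_) (fun k => ?_) hF ?_
    · exact hcm.mul (measurable_negExp.comp (hmeas _ (f k).measurable))
    · exact ae_of_all _ fun ω => mul_le_of_le_one_right' (negExp_le_one _)
    · filter_upwards [ae_lt_top hcm hF] with ω hω
      refine ENNReal.Tendsto.const_mul ?_ (Or.inr hω.ne)
      refine (continuous_negExp.tendsto _).comp ?_
      -- The sum over points becomes an integral against counting measure, so that monotone
      -- convergence applies.
      simp only [← MeasureTheory.lintegral_count]
      exact lintegral_tendsto_of_tendsto_of_monotone (fun k => Measurable.of_discrete.aemeasurable)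
        (ae_of_all _ fun n => hmono _) (ae_of_all _ fun n => hlim _)
  · simp_rw [hk]
    refine ENNReal.Tendsto.const_mul ?_ (Or.inr hF)
    refine (continuous_negExp.tendsto _).comp (ENNReal.Tendsto.const_mul ?_ (Or.inr ENNReal.ofReal_ne_top))
    refine lintegral_tendsto_of_tendsto_of_monotone (fun k => ?_) (ae_of_all _ fun y k l hkl => ?_)
      (ae_of_all _ fun y => ?_)
    · exact (measurable_const.sub (measurable_negExp.comp (f k).measurable)).aemeasurable
    · exact tsub_le_tsub_left (negExp_antitone (hmono y hkl)) _
    · exact ENNReal.Tendsto.sub tendsto_const_nhds ((continuous_negExp.tendsto _).comp (hlim y))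
        (Or.inl ENNReal.one_ne_top)

end Laplace

/-! ### Sums over the points of a Poisson process. -/

section Palm
open Filter Topology

variable {Ω : Type*} [MeasurableSpace Ω] {P : Measure Ω} {X : ℕ → Ω → Plane} {lam : ℝ}

/-- Radii that cut the plane into annuli which contain `ε` points of a Poisson process of density
`lam` on average. -/
noncomputable def annulusRadius (lam ε : ℝ) (k : ℕ) : ℝ := √(k * ε / (Real.pi * lam))

/-- Annulus that contains `ε` points of a Poisson process of density `lam` on average. -/
def annulus (lam ε : ℝ) (k : ℕ) : Set Plane :=
  Metric.ball 0 (annulusRadius lam ε (k + 1)) \ Metric.ball 0 (annulusRadius lam ε k)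

lemma mem_annulus {ε : ℝ} {k : ℕ} {y : Plane} :
    y ∈ annulus lam ε k ↔ annulusRadius lam ε k ≤ ‖y‖ ∧ ‖y‖ < annulusRadius lam ε (k + 1) := by
  simp [annulus, and_comm]

lemma measurableSet_annulus (ε : ℝ) (k : ℕ) : MeasurableSet (annulus lam ε k) :=
  Metric.isOpen_ball.measurableSet.diff Metric.isOpen_ball.measurableSet

lemma annulusRadius_nonneg (lam ε : ℝ) (k : ℕ) : 0 ≤ annulusRadius lam ε k := Real.sqrt_nonneg _

lemma annulusRadius_sq (hlam : 0 < lam) {ε : ℝ} (hε : 0 < ε) (k : ℕ) :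
    annulusRadius lam ε k ^ 2 = k * ε / (Real.pi * lam) :=
  Real.sq_sqrt (by positivity)

lemma annulusRadius_mono (hlam : 0 < lam) {ε : ℝ} (hε : 0 < ε) :
    Monotone (annulusRadius lam ε) := fun k l h =>
  Real.sqrt_le_sqrt (by
    have : (k : ℝ) ≤ l := Nat.cast_le.2 h
    gcongr)

lemma volume_ball_annulusRadius (hlam : 0 < lam) {ε : ℝ} (hε : 0 < ε) (k : ℕ) :
    volume (Metric.ball (0 : Plane) (annulusRadius lam ε k)) = ENNReal.ofReal (k * ε / lam) := by
  rw [EuclideanSpace.volume_ball_fin_two, ← ENNReal.ofReal_pow (annulusRadius_nonneg _ _ _),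
    annulusRadius_sq hlam hε, ← ENNReal.ofReal_mul (by positivity)]
  congr 1
  field_simp

lemma volume_annulus (hlam : 0 < lam) {ε : ℝ} (hε : 0 < ε) (k : ℕ) :
    volume (annulus lam ε k) = ENNReal.ofReal (ε / lam) := by
  rw [annulus, measure_sdiff
    (Metric.ball_subset_ball (annulusRadius_mono hlam hε (Nat.le_succ k)))
    Metric.isOpen_ball.measurableSet.nullMeasurableSet measure_ball_lt_top.ne,
    volume_ball_annulusRadius hlam hε, volume_ball_annulusRadius hlam hε,
    ← ENNReal.ofReal_sub _ (by positivity)]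
  congr 1
  push_cast
  ring

lemma tsum_indicator_annulus (hlam : 0 < lam) {ε : ℝ} (hε : 0 < ε) (y : Plane) :
    ∑' k, (annulus lam ε k).indicator (fun _ => (1 : ℝ≥0∞)) y = 1 := by
  classical
  have hex : ∃ k, ‖y‖ < annulusRadius lam ε (k + 1) := by
    obtain ⟨k, hk⟩ := exists_nat_gt (‖y‖ ^ 2 * (Real.pi * lam) / ε)
    refine ⟨k, Real.lt_sqrt_of_sq_lt ?_⟩
    have hpl : 0 < Real.pi * lam := by positivity
    rw [lt_div_iff₀ hpl]
    rw [div_lt_iff₀ hε] at hk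
    push_cast
    nlinarith
  rw [tsum_eq_single (Nat.find hex)]
  · rw [Set.indicator_of_mem]
    refine mem_annulus.2 ⟨?_, Nat.find_spec hex⟩
    rcases hk : Nat.find hex with _ | k
    · simp [annulusRadius]
    · exact not_lt.1 (Nat.find_min hex (by omega : k < Nat.find hex))
  · intro k hk
    rw [Set.indicator_of_notMem]
    intro h
    obtain ⟨h1, h2⟩ := mem_annulus.1 h
    have h3 := Nat.find_min' hex h2
    have h4 : Nat.find hex + 1 ≤ k := by omega
    exact absurd ((Nat.find_spec hex).trans_le (annulusRadius_mono hlam hε h4)) (not_lt.2 h1)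

/-- The integrand is at most one, so deleting the test function on `A` costs at most the area of
`A`. -/
lemma lintegral_one_sub_negExp_indicator_compl (φ : Plane → ℝ≥0∞)
    {A : Set Plane} (hA : MeasurableSet A) :
    ∫⁻ y, (1 - negExp (φ y)) ≤ (∫⁻ y, (1 - negExp (Aᶜ.indicator φ y))) + volume A := by
  calc ∫⁻ y, (1 - negExp (φ y))
      ≤ ∫⁻ y, ((1 - negExp (Aᶜ.indicator φ y)) + A.indicator 1 y) := by
        refine lintegral_mono fun y => ?_
        by_cases hy : y ∈ A
        · simp [hy]
        · simp [hy]
    _ = _ := by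
        rw [lintegral_add_right _ (measurable_one.indicator hA), lintegral_indicator_one hA]

/-- The term of the `n`-th point in a sum over the points of the configuration `x` of a functional
of the other points. -/
noncomputable def palmTerm (φ : ℝ → Plane → ℝ≥0∞) (γ : ℝ) (x : ℕ → Plane) (n : ℕ) : ℝ≥0∞ :=
  negExp (∑' m, if m ≠ n then φ ‖x n‖ (x m) else 0) * negExp (ENNReal.ofReal (γ * ‖x n‖ ^ 2))

lemma measurable_palmTerm (hX : ∀ n, Measurable (X n)) {φ : ℝ → Plane → ℝ≥0∞}
    (hφ : Measurable (Function.uncurry φ)) (γ : ℝ) (n : ℕ) :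
    Measurable (fun ω => palmTerm φ γ (fun k => X k ω) n) := by
  unfold palmTerm
  have h1 := fun n => (hX n).norm
  refine (measurable_negExp.comp (Measurable.tsum fun m => ?_)).mul (by fun_prop)
  split_ifs
  · exact hφ.comp ((h1 n).prodMk (hX m))
  · exact measurable_const

/-- By monotonicity each point of the annulus may be moved to the inner radius. Dropping all points
of the annulus from the inner sum then decouples the count in the annulus from the points outside
it. -/
lemma tsum_palmTerm_annulus_le {φ : ℝ → Plane → ℝ≥0∞}
    (hmono : ∀ s t y, 0 ≤ s → s ≤ t → φ s y ≤ φ t y) {γ : ℝ} (hγ : 0 ≤ γ) (x : ℕ → Plane)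
    (ε : ℝ) (k : ℕ) :
    ∑' n, (annulus lam ε k).indicator (fun _ => (1 : ℝ≥0∞)) (x n) * palmTerm φ γ x n ≤
      negExp (ENNReal.ofReal (γ * annulusRadius lam ε k ^ 2)) *
      ((count x (annulus lam ε k) : ℝ≥0∞) *
        negExp (∑' m, (annulus lam ε k)ᶜ.indicator (φ (annulusRadius lam ε k)) (x m))) := by
  rw [← tsum_indicator_eq_count, mul_left_comm, ← ENNReal.tsum_mul_right]
  refine ENNReal.tsum_le_tsum fun n => ?_
  by_cases hn : x n ∈ annulus lam ε k
  swap; · simp [hn]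
  have h0 := annulusRadius_nonneg lam ε k
  have h1 := (mem_annulus.1 hn).1
  gcongr
  rw [palmTerm, mul_comm]
  refine mul_le_mul' (negExp_antitone ?_) (negExp_antitone (ENNReal.tsum_le_tsum fun m => ?_))
  · gcongr
  · split_ifs with hm
    · exact (Set.indicator_le_self _ _ _).trans (hmono _ _ _ h0 h1)
    · rw [not_not] at hm
      simp [hm, hn]

/-- If the annulus holds exactly one point, the points other than it are exactly the points outside
the annulus, so nothing is lost in the inner sum; the outer radius gives the bound in this
direction. -/
lemma le_tsum_palmTerm_annulus {φ : ℝ → Plane → ℝ≥0∞}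
    (hmono : ∀ s t y, 0 ≤ s → s ≤ t → φ s y ≤ φ t y) {γ : ℝ} (hγ : 0 ≤ γ) (x : ℕ → Plane)
    (ε : ℝ) (k : ℕ) :
    negExp (ENNReal.ofReal (γ * annulusRadius lam ε (k + 1) ^ 2)) *
      ((if count x (annulus lam ε k) = 1 then 1 else 0) *
        negExp (∑' m, (annulus lam ε k)ᶜ.indicator (φ (annulusRadius lam ε (k + 1))) (x m))) ≤
    ∑' n, (annulus lam ε k).indicator (fun _ => (1 : ℝ≥0∞)) (x n) * palmTerm φ γ x n := by
  split_ifs with h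
  swap; · simp
  obtain ⟨n, hn⟩ := Set.encard_eq_one.1 h
  have hmem : ∀ m, x m ∈ annulus lam ε k ↔ m = n := fun m => by
    have := Set.ext_iff.1 hn m
    simpa using this
  refine le_trans ?_ (ENNReal.le_tsum n)
  have hnn := (hmem n).2 rfl
  have h2 := (mem_annulus.1 hnn).2.le
  rw [Set.indicator_of_mem hnn, one_mul, one_mul, palmTerm, mul_comm]
  refine mul_le_mul' (negExp_antitone (ENNReal.tsum_le_tsum fun m => ?_)) (negExp_antitone ?_)
  · split_ifs with hm
    · rw [Set.indicator_of_mem (by simpa [hmem] using hm)]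
      exact hmono _ _ _ (norm_nonneg _) h2
    · exact bot_le
  · gcongr

lemma hasSum_exp_neg_mul {c ε : ℝ} (hc : 0 < c) (hε : 0 < ε) :
    HasSum (fun k : ℕ => Real.exp (-(c * (k * ε)))) (1 - Real.exp (-(c * ε)))⁻¹ := by
  have h : Real.exp (-(c * ε)) < 1 := Real.exp_lt_one_iff.2 (by nlinarith [mul_pos hc hε])
  convert! hasSum_geometric_of_lt_one (Real.exp_pos _).le h using 2 with k
  rw [← Real.exp_nat_mul]
  congr 1; ring

/-- Sum over the points of a Poisson process of an isotropic multiplicative functional of the other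
points, as the Mecke formula gives it. -/
theorem IsPoissonProcess.lintegral_tsum_palmTerm [IsProbabilityMeasure P]
    (hX : IsPoissonProcess P X lam) (hlam : 0 < lam) {φ : ℝ → Plane → ℝ≥0∞}
    (hφ : Measurable (Function.uncurry φ))
    (hmono : ∀ s t y, 0 ≤ s → s ≤ t → φ s y ≤ φ t y) {K γ : ℝ} (hK : 0 < K) (hγ : 0 ≤ γ)
    (hint : ∀ t, 0 ≤ t → ∫⁻ y, (1 - negExp (φ t y)) = ENNReal.ofReal (K * t ^ 2)) :
    ∫⁻ ω, ∑' n, palmTerm φ γ (fun k => X k ω) n ∂P =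
      ENNReal.ofReal (K / Real.pi + γ / (Real.pi * lam))⁻¹ := by
  -- The exponent `lam * K * r ^ 2 + γ * r ^ 2` at the radius of index `k` equals `c * (k * ε)`, so
  -- the sum over annuli is geometric.
  set c := K / Real.pi + γ / (Real.pi * lam) with hc_def
  have hc : 0 < c := by positivity
  have hφt : ∀ t, Measurable (φ t) := fun t => hφ.comp measurable_prodMk_left
  have hdecomp : ∀ ε, 0 < ε → ∫⁻ ω, ∑' n, palmTerm φ γ (fun k => X k ω) n ∂P =
      ∑' k, ∫⁻ ω, ∑' n, (annulus lam ε k).indicator (fun _ => (1 : ℝ≥0∞)) (X n ω) *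
        palmTerm φ γ (fun k => X k ω) n ∂P := by
    intro ε hε
    rw [← lintegral_tsum]
    · refine lintegral_congr fun ω => ?_
      rw [ENNReal.tsum_comm]
      refine tsum_congr fun n => ?_
      rw [ENNReal.tsum_mul_right, tsum_indicator_annulus hlam hε, one_mul]
    · intro k
      refine (Measurable.tsum fun n => Measurable.mul ?_
        (measurable_palmTerm hX.measurable hφ γ n)).aemeasurable
      exact (measurable_const.indicator (measurableSet_annulus ε k)).comp (hX.measurable n)
  have hvol : ∀ ε, 0 < ε → ∀ k, volume (annulus lam ε k) ≠ ∞ := fun ε hε k => by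
    rw [volume_annulus hlam hε]; exact ENNReal.ofReal_ne_top
  have hlv : ∀ ε, 0 < ε → ∀ k, ENNReal.ofReal lam * volume (annulus lam ε k) = ENNReal.ofReal ε := by
    intro ε hε k
    rw [volume_annulus hlam hε, ← ENNReal.ofReal_mul hlam.le, mul_div_cancel₀ _ hlam.ne']
  have hlapl : ∀ ε (k : ℕ) t (F : ℕ∞ → ℝ≥0∞),
      ∫⁻ ω, F (count (fun n => X n ω) (annulus lam ε k)) ∂P ≠ ∞ → _ := fun ε k t F hF =>
    hX.lintegral_mul_negExp_tsum hlam.le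
      ((hφt t).indicator (measurableSet_annulus (lam := lam) ε k).compl)
      (measurableSet_annulus (lam := lam) ε k) (F := F) (fun y hy => by simp [hy]) hF
  have hexp : ∀ ε, 0 < ε → ∀ k : ℕ,
      negExp (ENNReal.ofReal (γ * annulusRadius lam ε k ^ 2)) *
        negExp (ENNReal.ofReal lam * ENNReal.ofReal (K * annulusRadius lam ε k ^ 2)) =
        ENNReal.ofReal (Real.exp (-(c * (k * ε)))) := by
    intro ε hε k
    rw [← negExp_add, ← ENNReal.ofReal_mul hlam.le, ← ENNReal.ofReal_add (by positivity)
      (by positivity), negExp_ofReal (by positivity), annulusRadius_sq hlam hε, hc_def]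
    congr 3
    field_simp
    ring
  -- The mean count is `ε`; the factor `exp ε` pays for the annulus missing from the integral.
  have hupper : ∀ ε, 0 < ε → ∫⁻ ω, ∑' n, palmTerm φ γ (fun k => X k ω) n ∂P ≤
      ENNReal.ofReal (ε * Real.exp ε * (1 - Real.exp (-(c * ε)))⁻¹) := by
    intro ε hε
    have hs := (hasSum_exp_neg_mul hc hε).mul_left (ε * Real.exp ε)
    rw [hdecomp ε hε, ← hs.tsum_eq, ENNReal.ofReal_tsum_of_nonneg (fun k => by positivity)
      hs.summable]
    refine ENNReal.tsum_le_tsum fun k => ?_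
    refine (lintegral_mono fun ω => tsum_palmTerm_annulus_le hmono hγ _ ε k).trans ?_
    have hcnt := hX.lintegral_count hlam.le (measurableSet_annulus ε k) (hvol ε hε k)
    rw [lintegral_const_mul' _ _ (negExp_ne_top _),
      hlapl ε k _ (fun j => (j : ℝ≥0∞)) (by rw [hcnt, hlv ε hε]; exact ENNReal.ofReal_ne_top),
      hcnt, hlv ε hε, ENNReal.ofReal_mul (p := ε * Real.exp ε) (by positivity),
      ENNReal.ofReal_mul (p := ε) hε.le,
      ← hexp ε hε]
    have h1 := lintegral_one_sub_negExp_indicator_compl (φ (annulusRadius lam ε k))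
      (measurableSet_annulus (lam := lam) ε k)
    rw [hint _ (annulusRadius_nonneg _ _ _)] at h1
    have h2 := negExp_antitone (mul_le_mul_right h1 (ENNReal.ofReal lam))
    rw [mul_add, negExp_add, hlv ε hε, negExp_ofReal hε.le] at h2
    have h3 : ENNReal.ofReal (Real.exp (-ε)) * ENNReal.ofReal (Real.exp ε) = 1 := by
      rw [← ENNReal.ofReal_mul (Real.exp_pos _).le, ← Real.exp_add]; simp
    have h4 := mul_le_mul_left h2 (ENNReal.ofReal (Real.exp ε))
    rw [mul_assoc, h3, mul_one] at h4
    rw [mul_left_comm, mul_assoc (ENNReal.ofReal ε)]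
    refine mul_le_mul_right ?_ _
    rw [mul_left_comm, mul_comm (ENNReal.ofReal (Real.exp ε))]
    exact mul_le_mul_right h4 _
  -- Exactly one point occurs with probability `ε * exp (-ε)`; `exp (-(c * ε))` comes from using the
  -- radius of index `k + 1`. The missing annulus only helps.
  have hlower : ∀ ε, 0 < ε →
      ENNReal.ofReal (ε * Real.exp (-ε) * Real.exp (-(c * ε)) * (1 - Real.exp (-(c * ε)))⁻¹) ≤
      ∫⁻ ω, ∑' n, palmTerm φ γ (fun k => X k ω) n ∂P := by
    intro ε hε
    have hs := (hasSum_exp_neg_mul hc hε).mul_left (ε * Real.exp (-ε) * Real.exp (-(c * ε)))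
    rw [hdecomp ε hε, ← hs.tsum_eq, ENNReal.ofReal_tsum_of_nonneg (fun k => by positivity)
      hs.summable]
    refine ENNReal.tsum_le_tsum fun k => ?_
    refine le_trans ?_ (lintegral_mono fun ω => le_tsum_palmTerm_annulus hmono hγ _ ε k)
    have hcnt : ∫⁻ ω, (if count (fun n => X n ω) (annulus lam ε k) = 1 then 1 else 0) ∂P =
        ENNReal.ofReal (ε * Real.exp (-ε)) := by
      rw [hX.lintegral_comp_count (measurableSet_annulus ε k) (hvol ε hε k)
        (fun j => if j = 1 then 1 else 0), lintegral_countable', tsum_eq_single 1]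
      · have : lam * volume.real (annulus lam ε k) = ε := by
          rw [measureReal_def, volume_annulus hlam hε, ENNReal.toReal_ofReal (by positivity),
            mul_div_cancel₀ _ hlam.ne']
        rw [poissonMeasure_singleton, this]
        simp [hε.le, mul_comm]
      · intro j hj
        simp [hj]
    rw [lintegral_const_mul' _ _ (negExp_ne_top _),
      hlapl ε k _ (fun j => if j = 1 then 1 else 0) (by rw [hcnt]; exact ENNReal.ofReal_ne_top),
      hcnt, mul_assoc, ENNReal.ofReal_mul (p := ε * Real.exp (-ε)) (by positivity),
      mul_left_comm (negExp _)]
    gcongr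
    rw [← Real.exp_add]
    calc _ = ENNReal.ofReal (Real.exp (-(c * ((k + 1 : ℕ) * ε)))) := by
          congr 2; push_cast; ring
      _ = _ := (hexp ε hε (k + 1)).symm
      _ ≤ _ := by
          gcongr
          refine negExp_antitone (mul_le_mul_right ?_ _)
          rw [← hint _ (annulusRadius_nonneg _ _ _)]
          refine lintegral_mono fun y => tsub_le_tsub_left (negExp_antitone ?_) _
          exact Set.indicator_le_self _ _ _
  have hineq : ∀ ε, 0 < ε → 0 < 1 - Real.exp (-(c * ε)) := fun ε hε =>
    sub_pos.2 (Real.exp_lt_one_iff.2 (by nlinarith [mul_pos hc hε]))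
  refine le_antisymm ?_ ?_
  -- Both bounds tend to `c⁻¹` as `ε → 0`, because `x * exp (-x) ≤ 1 - exp (-x) ≤ x` at `x = c * ε`;
  -- the left inequality serves here, the right one in the other half.
  · have hlim : Tendsto (fun ε => ENNReal.ofReal (Real.exp ε * Real.exp (c * ε) * c⁻¹))
        (𝓝[>] 0) (𝓝 (ENNReal.ofReal c⁻¹)) := by
      refine (ENNReal.continuous_ofReal.tendsto' _ _ rfl).comp ?_
      have : Continuous fun ε => Real.exp ε * Real.exp (c * ε) * c⁻¹ := by fun_prop
      exact (this.tendsto' 0 _ (by simp)).mono_left nhdsWithin_le_nhds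
    refine ge_of_tendsto hlim ?_
    filter_upwards [self_mem_nhdsWithin] with ε hε
    refine (hupper ε hε).trans (ENNReal.ofReal_le_ofReal ?_)
    have hε' : (0 : ℝ) < ε := hε
    have h1 : c * ε * Real.exp (-(c * ε)) ≤ 1 - Real.exp (-(c * ε)) := by
      have h2 := Real.add_one_le_exp (c * ε)
      have h3 := mul_le_mul_of_nonneg_right h2 (Real.exp_pos (-(c * ε))).le
      rw [← Real.exp_add, add_neg_cancel, Real.exp_zero] at h3
      linarith
    have h4 := hineq ε hε
    rw [← div_eq_mul_inv, ← div_eq_mul_inv, div_le_div_iff₀ h4 hc]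
    have h5 := mul_le_mul_of_nonneg_left h1
      (by positivity : 0 ≤ Real.exp ε * Real.exp (c * ε))
    have h6 : Real.exp (c * ε) * Real.exp (-(c * ε)) = 1 := by
      rw [← Real.exp_add]; simp
    calc ε * Real.exp ε * c
        = Real.exp ε * (c * ε) * (Real.exp (c * ε) * Real.exp (-(c * ε))) := by rw [h6]; ring
      _ = Real.exp ε * Real.exp (c * ε) * (c * ε * Real.exp (-(c * ε))) := by ring
      _ ≤ _ := h5
  · have hlim : Tendsto (fun ε => ENNReal.ofReal (Real.exp (-ε) * Real.exp (-(c * ε)) * c⁻¹))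
        (𝓝[>] 0) (𝓝 (ENNReal.ofReal c⁻¹)) := by
      refine (ENNReal.continuous_ofReal.tendsto' _ _ rfl).comp ?_
      have : Continuous fun ε => Real.exp (-ε) * Real.exp (-(c * ε)) * c⁻¹ := by fun_prop
      exact (this.tendsto' 0 _ (by simp)).mono_left nhdsWithin_le_nhds
    refine le_of_tendsto hlim ?_
    filter_upwards [self_mem_nhdsWithin] with ε hε
    refine le_trans (ENNReal.ofReal_le_ofReal ?_) (hlower ε hε)
    have hε' : (0 : ℝ) < ε := hε
    have h1 : 1 - Real.exp (-(c * ε)) ≤ c * ε := by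
      linarith [Real.add_one_le_exp (-(c * ε))]
    have h4 := hineq ε hε
    rw [← div_eq_mul_inv, ← div_eq_mul_inv, div_le_div_iff₀ hc h4]
    have h5 := mul_le_mul_of_nonneg_left h1
      (by positivity : 0 ≤ Real.exp (-ε) * Real.exp (-(c * ε)))
    linarith

end Palm

/-! ### Radial integrals over the plane. -/

section Integrals
open Set

/-- Polar coordinates in the variable `‖y‖ ^ 2`: the disc of radius `√x` has area `π x`, and
intervals with rational ends determine the measure. -/
lemma map_norm_sq_volume :
    (volume : Measure Plane).map (fun y => ‖y‖ ^ 2) =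
      ENNReal.ofReal Real.pi • (volume : Measure ℝ).restrict (Ioi 0) := by
  have hloc : IsLocallyFiniteMeasure
      (ENNReal.ofReal Real.pi • (volume : Measure ℝ).restrict (Ioi 0)) :=
    ⟨fun x => ⟨Metric.ball x 1, Metric.ball_mem_nhds x one_pos, by
      rw [Measure.smul_apply, smul_eq_mul]
      exact ENNReal.mul_lt_top ENNReal.ofReal_lt_top measure_ball_lt_top⟩⟩
  symm
  refine Real.measure_ext_Ioo_rat fun a b => ?_
  have hR : (ENNReal.ofReal Real.pi • (volume : Measure ℝ).restrict (Ioi 0)) (Ioo (a : ℝ) b) =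
      ENNReal.ofReal (Real.pi * (b - max (a : ℝ) 0)) := by
    rw [Measure.smul_apply, Measure.restrict_apply measurableSet_Ioo, Ioo_inter_Ioi,
      Real.volume_Ioo, smul_eq_mul, ENNReal.ofReal_mul Real.pi_pos.le]
  rw [hR, Measure.map_apply (by fun_prop) measurableSet_Ioo]
  have hball : ∀ x : ℝ, 0 ≤ x → volume (Metric.ball (0 : Plane) (√x)) = ENNReal.ofReal (Real.pi * x) := by
    intro x hx
    rw [EuclideanSpace.volume_ball_fin_two, ← ENNReal.ofReal_pow (Real.sqrt_nonneg _),
      Real.sq_sqrt hx, ← ENNReal.ofReal_mul hx, mul_comm]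
  rcases le_or_gt (b : ℝ) (max a 0) with hb | hb
  · rw [ENNReal.ofReal_of_nonpos (by nlinarith [Real.pi_pos])]
    have : (fun y : Plane => ‖y‖ ^ 2) ⁻¹' Ioo (a : ℝ) b = ∅ := by
      ext y
      simp only [mem_preimage, mem_Ioo, mem_empty_iff_false, iff_false, not_and, not_lt]
      intro hy
      exact hb.trans (max_le hy.le (sq_nonneg _))
    rw [this, measure_empty]
  · have hb0 : 0 < (b : ℝ) := (le_max_right _ _).trans_lt hb
    rcases lt_or_ge (a : ℝ) 0 with ha | ha
    · rw [max_eq_right ha.le, sub_zero, ← hball _ hb0.le]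
      congr 1
      ext y
      simp only [Metric.mem_ball, dist_zero_right, mem_preimage, mem_Ioo]
      rw [Real.lt_sqrt (norm_nonneg _)]
      exact ⟨fun h => ⟨ha.trans_le (sq_nonneg _), h⟩, fun h => h.2⟩
    · rw [max_eq_left ha] at hb ⊢
      have : (fun y : Plane => ‖y‖ ^ 2) ⁻¹' Ioo (a : ℝ) b =
          Metric.ball 0 (√b) \ Metric.closedBall 0 (√a) := by
        ext y
        simp only [mem_sdiff, Metric.mem_ball, Metric.mem_closedBall, dist_zero_right, mem_preimage,
          mem_Ioo, not_le]
        rw [Real.lt_sqrt (norm_nonneg _), Real.sqrt_lt ha (norm_nonneg _)]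
        exact and_comm
      rw [this, measure_sdiff (Metric.closedBall_subset_ball (Real.sqrt_lt_sqrt ha hb))
        Metric.isClosed_closedBall.measurableSet.nullMeasurableSet measure_closedBall_lt_top.ne,
        Measure.addHaar_closedBall_eq_addHaar_ball, hball _ hb0.le, hball _ ha,
        ← ENNReal.ofReal_sub _ (by positivity), mul_sub]

lemma lintegral_norm_sq {F : ℝ → ℝ≥0∞} (hF : Measurable F) :
    ∫⁻ y : Plane, F (‖y‖ ^ 2) = ENNReal.ofReal Real.pi * ∫⁻ v in Ioi 0, F v := by
  rw [← lintegral_map (f := F) (g := fun y : Plane => ‖y‖ ^ 2) hF (by fun_prop),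
    map_norm_sq_volume, lintegral_smul_measure, smul_eq_mul]

/-- The integrand is at most `1` on `(0, 1]` and at most `u ^ (-q)` beyond. -/
lemma integrableOn_one_div_one_add_rpow {q : ℝ} (hq : 1 < q) {A : ℝ} (hA : 0 ≤ A) :
    IntegrableOn (fun u : ℝ => 1 / (1 + u ^ q)) (Ioi A) := by
  have hmeas : Measurable (fun u : ℝ => 1 / (1 + u ^ q)) := by fun_prop
  have h1 : IntegrableOn (fun u : ℝ => 1 / (1 + u ^ q)) (Ioc 0 1) := by
    refine Measure.integrableOn_of_bounded (M := 1) (by simp) hmeas.aestronglyMeasurable ?_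
    filter_upwards [ae_restrict_mem measurableSet_Ioc] with u hu
    have := Real.rpow_nonneg hu.1.le q
    rw [Real.norm_of_nonneg (by positivity), div_le_one (by positivity)]
    linarith
  have h2 : IntegrableOn (fun u : ℝ => 1 / (1 + u ^ q)) (Ioi 1) := by
    refine (integrableOn_Ioi_rpow_of_lt (a := -q) (by linarith) one_pos).mono'
      hmeas.aestronglyMeasurable ?_
    filter_upwards [ae_restrict_mem measurableSet_Ioi] with u hu
    have hu0 : (0 : ℝ) < u := one_pos.trans hu
    have := Real.rpow_pos_of_pos hu0 q
    rw [Real.norm_of_nonneg (by positivity), Real.rpow_neg hu0.le, ← one_div]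
    exact one_div_le_one_div_of_le this (by linarith)
  have h3 := h1.union h2
  rw [Ioc_union_Ioi_eq_Ioi zero_le_one] at h3
  exact h3.mono_set (Ioi_subset_Ioi hA)

/-- Write the integrand as `∫ exp (-(1 + u ^ q) s) ds` and swap the integrals. The inner one is `Γ(δ
+ 1) exp (-s) s ^ (-δ)`, the outer one gives `Γ(1 - δ) Γ(δ + 1)`, and the reflection formula
finishes. -/
lemma integral_one_div_one_add_rpow {δ : ℝ} (h0 : 0 < δ) (h1 : δ < 1) :
    ∫ u in Ioi (0 : ℝ), 1 / (1 + u ^ (1 / δ)) = Real.pi * δ * (1 / Real.sin (Real.pi * δ)) := by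
  set q := 1 / δ with hq
  have hq1 : 1 < q := by rw [hq, lt_div_iff₀ h0]; linarith
  have hq0 : 0 < q := by linarith
  have hqδ : 1 / q = δ := by rw [hq]; simp
  have key1 : ∀ u ∈ Ioi (0 : ℝ), ENNReal.ofReal (1 / (1 + u ^ q)) =
      ∫⁻ s in Ioi (0 : ℝ), ENNReal.ofReal (Real.exp (-(1 + u ^ q) * s)) := by
    intro u hu
    have hu' := Real.rpow_pos_of_pos hu q
    have hneg : -(1 + u ^ q) < 0 := by linarith
    rw [← ofReal_integral_eq_lintegral_ofReal (integrableOn_exp_mul_Ioi hneg 0)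
      (ae_of_all _ fun s => (Real.exp_pos _).le), integral_exp_mul_Ioi hneg]
    rw [mul_zero, Real.exp_zero, neg_div_neg_eq]
  have key2 : ∀ s ∈ Ioi (0 : ℝ),
      ∫⁻ u in Ioi (0 : ℝ), ENNReal.ofReal (Real.exp (-(1 + u ^ q) * s)) =
      ENNReal.ofReal (Real.exp (-s) * s ^ ((1 - δ) - 1) * Real.Gamma (δ + 1)) := by
    intro s hs
    have hs0 : (0 : ℝ) < s := hs
    have hI := integral_exp_neg_mul_rpow hq0 hs0
    rw [hqδ, neg_div, hqδ] at hI
    have hG := Real.Gamma_pos_of_pos (by linarith : 0 < δ + 1)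
    have hint : IntegrableOn (fun x : ℝ => Real.exp (-s * x ^ q)) (Ioi 0) := by
      -- Integrability follows from the nonzero value, since the integral of a non-integrable
      -- function is zero by convention.
      refine Integrable.of_integral_ne_zero ?_
      rw [hI]
      have := Real.rpow_pos_of_pos hs0 (-δ)
      positivity
    have : (1 - δ) - 1 = -δ := by ring
    rw [this, mul_assoc, ← hI, ENNReal.ofReal_mul (Real.exp_pos _).le,
      ofReal_integral_eq_lintegral_ofReal hint (ae_of_all _ fun s => (Real.exp_pos _).le),
      ← lintegral_const_mul _ (by fun_prop)]
    refine lintegral_congr fun u => ?_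
    rw [← ENNReal.ofReal_mul (Real.exp_pos _).le, ← Real.exp_add]
    congr 2; ring
  have hGam := Real.Gamma_eq_integral (by linarith : 0 < 1 - δ)
  have hmain : ENNReal.ofReal (∫ u in Ioi (0 : ℝ), 1 / (1 + u ^ q)) =
      ENNReal.ofReal (Real.Gamma (1 - δ) * Real.Gamma (δ + 1)) := by
    rw [ofReal_integral_eq_lintegral_ofReal (integrableOn_one_div_one_add_rpow hq1 le_rfl),
      setLIntegral_congr_fun measurableSet_Ioi key1, lintegral_lintegral_swap,
      setLIntegral_congr_fun measurableSet_Ioi key2, hGam, ← integral_mul_const,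
      ofReal_integral_eq_lintegral_ofReal]
    · exact (Real.GammaIntegral_convergent (by linarith)).mul_const _
    · filter_upwards [ae_restrict_mem measurableSet_Ioi] with s hs
      have := Real.rpow_nonneg (le_of_lt hs) (1 - δ - 1)
      have hG := Real.Gamma_pos_of_pos (by linarith : 0 < δ + 1)
      positivity
    · fun_prop
    · filter_upwards [ae_restrict_mem measurableSet_Ioi] with u hu
      have := Real.rpow_nonneg (le_of_lt hu) q
      positivity
  have hG1 := Real.Gamma_pos_of_pos (by linarith : 0 < δ + 1)
  have hG2 := Real.Gamma_pos_of_pos (by linarith : 0 < 1 - δ)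
  rw [ENNReal.ofReal_eq_ofReal_iff (setIntegral_nonneg measurableSet_Ioi fun u hu => by
    have := Real.rpow_nonneg (le_of_lt hu) q
    positivity) (by positivity)] at hmain
  rw [hmain, Real.Gamma_add_one h0.ne']
  have := Real.Gamma_mul_Gamma_one_sub δ
  calc _ = δ * (Real.Gamma δ * Real.Gamma (1 - δ)) := by ring
    _ = _ := by rw [this]; ring

lemma H_half {β R : ℝ} (hβ : 0 < β) (hR : 0 < R) :
    H β (1 / 2) R = β ^ (1 / 2 : ℝ) * Real.arctan (R ^ 2 * β ^ (1 / 2 : ℝ)) := by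
  rw [H]
  congr 1
  have h : ∀ u : ℝ, 1 / (1 + u ^ (1 / (1 / 2 : ℝ))) = (1 + u ^ 2)⁻¹ := by
    intro u
    rw [one_div_one_div, Real.rpow_two, one_div]
  have hb := Real.rpow_pos_of_pos hβ (1 / 2)
  have h2 : R ^ (-2 : ℤ) * β ^ (-(1 / 2) : ℝ) = (R ^ 2 * β ^ (1 / 2 : ℝ))⁻¹ := by
    rw [Real.rpow_neg hβ.le, mul_inv, zpow_neg]; rfl
  simp_rw [h]
  rw [integral_Ioi_inv_one_add_sq, h2, Real.arctan_inv_of_pos (by positivity)]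
  ring

/-- Laplace transform at `a` of the product of a Bernoulli variable of parameter `p` and an
independent exponential variable. -/
noncomputable def thinLaplace (p a : ℝ≥0∞) : ℝ≥0∞ := (1 - p) + p * (1 + a)⁻¹

lemma thinLaplace_le_one {p : ℝ≥0∞} (hp : p ≤ 1) (a : ℝ≥0∞) : thinLaplace p a ≤ 1 := by
  calc (1 - p) + p * (1 + a)⁻¹ ≤ (1 - p) + p * 1 := by
        gcongr; exact ENNReal.inv_le_one.2 le_self_add
    _ = 1 := by rw [mul_one, tsub_add_cancel_of_le hp]

lemma thinLaplace_antitone (p : ℝ≥0∞) : Antitone (thinLaplace p) := fun a b h => by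
  unfold thinLaplace; gcongr

@[fun_prop] lemma measurable_thinLaplace (p : ℝ≥0∞) : Measurable (thinLaplace p) := by
  unfold thinLaplace; fun_prop

lemma thinLaplace_zero {p : ℝ≥0∞} (hp : p ≤ 1) : thinLaplace p 0 = 1 := by
  simp [thinLaplace, tsub_add_cancel_of_le hp]

lemma one_sub_thinLaplace {p : ℝ≥0∞} (hp : p ≤ 1) (a : ℝ≥0∞) :
    1 - thinLaplace p a = p * (1 - (1 + a)⁻¹) := by
  have hp' : p ≠ ∞ := (hp.trans_lt ENNReal.one_lt_top).ne
  have h1 : (1 + a)⁻¹ ≤ 1 := ENNReal.inv_le_one.2 le_self_add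
  have h2 : (1 + a)⁻¹ ≠ ∞ := (h1.trans_lt ENNReal.one_lt_top).ne
  have h3 : thinLaplace p a ≠ ∞ := ((thinLaplace_le_one hp a).trans_lt ENNReal.one_lt_top).ne
  refine ENNReal.sub_eq_of_eq_add h3 ?_
  rw [thinLaplace, add_comm (1 - p), ← add_assoc, ← mul_add, tsub_add_cancel_of_le h1, mul_one,
    add_tsub_cancel_of_le hp]

/-- Exponent that a point at `y` contributes to the conditional coverage probability of a link of
length `t`, with an exclusion disc of radius `T * t`. -/
noncomputable def linkExponent (α b T : ℝ) (p : ℝ≥0∞) (t : ℝ) (y : Plane) : ℝ≥0∞ :=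
  if ‖y‖ < T * t then ∞
  else negLog (thinLaplace p (ENNReal.ofReal b * ENNReal.ofReal t ^ α * ‖y‖ₑ ^ (-α)))

lemma measurable_linkExponent_comp {γ : Type*} [MeasurableSpace γ] (α b T : ℝ) (p : ℝ≥0∞)
    {f : γ → ℝ} {g : γ → Plane} (hf : Measurable f) (hg : Measurable g) :
    Measurable (fun x => linkExponent α b T p (f x) (g x)) := by
  unfold linkExponent
  exact Measurable.ite (measurableSet_lt (by fun_prop) (by fun_prop)) measurable_const (by fun_prop)

lemma measurable_linkExponent (α b T : ℝ) (p : ℝ≥0∞) :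
    Measurable (Function.uncurry (linkExponent α b T p)) :=
  measurable_linkExponent_comp α b T p measurable_fst measurable_snd

lemma linkExponent_mono {α b T : ℝ} (hα : 0 ≤ α) (hT : 0 ≤ T) (p : ℝ≥0∞) {s t : ℝ} (y : Plane)
    (h : s ≤ t) : linkExponent α b T p s y ≤ linkExponent α b T p t y := by
  unfold linkExponent
  split_ifs with h1 h2 h2
  · exact le_rfl
  · exact absurd (h1.trans_le (by gcongr)) h2
  · exact le_top
  · refine negLog_antitone (thinLaplace_antitone p ?_)
    gcongr

/-- Scaling: in the variable `u = ‖y‖ ^ 2 / (b ^ (2 / α) * t ^ 2)` the relative gain is `u ^ (-(α /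
2))`, and `1 - (1 + a)⁻¹ = 1 / (1 + a⁻¹)`. The origin is excluded because real powers there differ
from those in `[0, ∞]`. -/
lemma one_sub_negExp_linkExponent {α b T : ℝ} (hα : 0 < α) (hb : 0 < b) (hT : 0 ≤ T) {p : ℝ}
    (hp : p ∈ Icc (0 : ℝ) 1) {t : ℝ} (ht : 0 < t) {y : Plane} (hy : y ≠ 0) :
    1 - negExp (linkExponent α b T (ENNReal.ofReal p) t y) =
      if ‖y‖ ^ 2 < T ^ 2 * t ^ 2 then 1 else
        ENNReal.ofReal (p * (1 / (1 + ((b ^ (2 / α) * t ^ 2)⁻¹ * ‖y‖ ^ 2) ^ (α / 2)))) := by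
  have hp' : ENNReal.ofReal p ≤ 1 := ENNReal.ofReal_le_one.2 hp.2
  have hiff : ‖y‖ < T * t ↔ ‖y‖ ^ 2 < T ^ 2 * t ^ 2 := by
    rw [← mul_pow, sq_lt_sq₀ (norm_nonneg _) (by positivity)]
  rw [linkExponent]
  by_cases h : ‖y‖ < T * t
  · rw [if_pos h, if_pos (hiff.1 h), negExp_top, tsub_zero]
  rw [if_neg h, if_neg (mt hiff.2 h)]
  have hy0 : 0 < ‖y‖ := norm_pos_iff.2 hy
  rw [negExp_negLog (thinLaplace_le_one hp' _), one_sub_thinLaplace hp', ENNReal.ofReal_mul hp.1]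
  congr 1
  have h1 : ENNReal.ofReal b * ENNReal.ofReal t ^ α * ‖y‖ₑ ^ (-α) =
      ENNReal.ofReal (b * t ^ α * ‖y‖ ^ (-α)) := by
    rw [ENNReal.ofReal_rpow_of_pos ht, ← ofReal_norm, ENNReal.ofReal_rpow_of_pos hy0,
      ← ENNReal.ofReal_mul hb.le, ← ENNReal.ofReal_mul (by positivity)]
  have h2 : 0 < b * t ^ α * ‖y‖ ^ (-α) := by positivity
  rw [h1, ← ENNReal.ofReal_one, ← ENNReal.ofReal_add zero_le_one h2.le,
    ← ENNReal.ofReal_inv_of_pos (by linarith), ← ENNReal.ofReal_sub _ (by positivity)]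
  congr 1
  have h3 : ((b ^ (2 / α) * t ^ 2)⁻¹ * ‖y‖ ^ 2) ^ (α / 2) = (b * t ^ α * ‖y‖ ^ (-α))⁻¹ := by
    rw [Real.mul_rpow (by positivity) (by positivity), Real.inv_rpow (by positivity),
      Real.mul_rpow (by positivity) (by positivity), ← Real.rpow_mul hb.le, ← Real.rpow_natCast,
      ← Real.rpow_natCast, ← Real.rpow_mul ht.le, ← Real.rpow_mul hy0.le, Real.rpow_neg hy0.le,
      mul_inv]
    have e1 : 2 / α * (α / 2) = 1 := by field_simp
    have e2 : ((2 : ℕ) : ℝ) * (α / 2) = α := by push_cast; ring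
    rw [e1, e2, Real.rpow_one, mul_inv, mul_inv, inv_inv]
  rw [h3]
  field_simp
  ring

/-- Integral over the plane of the probability that a point spoils a link of length `t`. -/
lemma lintegral_one_sub_negExp_linkExponent {α b T : ℝ} (hα : 2 < α) (hb : 0 < b) (hT : 0 ≤ T)
    {p : ℝ} (hp : p ∈ Icc (0 : ℝ) 1) {t : ℝ} (ht : 0 ≤ t) :
    ∫⁻ y, (1 - negExp (linkExponent α b T (ENNReal.ofReal p) t y)) =
      ENNReal.ofReal (Real.pi * (T ^ 2 + p * (b ^ (2 / α) *
        ∫ u in Ioi (T ^ 2 * b ^ (-(2 / α))), 1 / (1 + u ^ (α / 2)))) * t ^ 2) := by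
  have hp' : ENNReal.ofReal p ≤ 1 := ENNReal.ofReal_le_one.2 hp.2
  have hα0 : 0 < α := by linarith
  rcases ht.eq_or_lt with rfl | ht
  · have : ∀ y : Plane, 1 - negExp (linkExponent α b T (ENNReal.ofReal p) 0 y) = 0 := by
      intro y
      have h : ¬ ‖y‖ < T * 0 := by simp
      rw [linkExponent, if_neg h, ENNReal.ofReal_zero, ENNReal.zero_rpow_of_pos hα0, mul_zero,
        zero_mul, thinLaplace_zero hp']
      simp
    simp [this]
  set B := b ^ (2 / α) with hB
  have hB0 : 0 < B := Real.rpow_pos_of_pos hb _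
  set c := (B * t ^ 2)⁻¹ with hc
  have hc0 : 0 < c := by positivity
  set f : ℝ → ℝ := fun u => 1 / (1 + u ^ (α / 2)) with hf
  have hfm : Measurable f := by rw [hf]; fun_prop
  let F : ℝ → ℝ≥0∞ := fun v => if v < T ^ 2 * t ^ 2 then 1 else ENNReal.ofReal (p * f (c * v))
  have hF : Measurable F := Measurable.ite measurableSet_Iio measurable_const (by fun_prop)
  have hae : ∀ᵐ y : Plane, y ≠ 0 := by
    rw [ae_iff]; simp
  have h1 : ∫⁻ y, (1 - negExp (linkExponent α b T (ENNReal.ofReal p) t y)) =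
      ∫⁻ y : Plane, F (‖y‖ ^ 2) := by
    refine lintegral_congr_ae ?_
    filter_upwards [hae] with y hy
    exact one_sub_negExp_linkExponent hα0 hb hT hp ht hy
  have hT0 : 0 ≤ T ^ 2 * t ^ 2 := by positivity
  rw [h1, lintegral_norm_sq hF,
    ← Ioc_union_Ioi_eq_Ioi hT0, lintegral_union measurableSet_Ioi Ioc_disjoint_Ioi_same]
  have h2 : ∫⁻ v in Ioc 0 (T ^ 2 * t ^ 2), F v = ENNReal.ofReal (T ^ 2 * t ^ 2) := by
    rw [← restrict_Ioo_eq_restrict_Ioc, setLIntegral_congr_fun (g := fun _ => 1) measurableSet_Ioo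
      (fun v hv => if_pos hv.2)]
    simp
  have h3 : ∫⁻ v in Ioi (T ^ 2 * t ^ 2), F v =
      ENNReal.ofReal (p * (B * t ^ 2 * ∫ u in Ioi (T ^ 2 * b ^ (-(2 / α))), f u)) := by
    -- The substitution `u = c * v` removes `t` from the lower limit; its Jacobian supplies the
    -- factor `b ^ (2 / α) * t ^ 2`.
    have hlow : c * (T ^ 2 * t ^ 2) = T ^ 2 * b ^ (-(2 / α)) := by
      rw [Real.rpow_neg hb.le, ← hB, hc]; field_simp
    have hint : IntegrableOn (fun v => f (c * v)) (Ioi (T ^ 2 * t ^ 2)) := by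
      rw [integrableOn_Ioi_comp_mul_left_iff f _ hc0]
      exact integrableOn_one_div_one_add_rpow (by linarith) (by positivity)
    rw [setLIntegral_congr_fun (g := fun v => ENNReal.ofReal (p * f (c * v))) measurableSet_Ioi
      (fun v hv => if_neg (not_lt.2 (le_of_lt hv))), ← ofReal_integral_eq_lintegral_ofReal
      (hint.const_mul p), integral_const_mul, integral_comp_mul_left_Ioi f _ hc0, hlow, smul_eq_mul,
      hc, inv_inv]
    filter_upwards [ae_restrict_mem measurableSet_Ioi] with v hv
    have hv0 : 0 ≤ v := hT0.trans (le_of_lt hv)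
    have hp0 := hp.1
    simp only [hf, Pi.zero_apply]
    positivity
  have hJ : 0 ≤ ∫ u in Ioi (T ^ 2 * b ^ (-(2 / α))), f u := by
    refine setIntegral_nonneg measurableSet_Ioi fun u hu => ?_
    have hu0 : 0 ≤ u := le_trans (by positivity) (le_of_lt hu)
    simp only [hf]
    positivity
  have hp0 := hp.1
  rw [h2, h3, ← ENNReal.ofReal_add hT0 (by positivity), ← ENNReal.ofReal_mul Real.pi_pos.le]
  congr 1
  ring

end Integrals

/-! ### Integrating out independent variables. -/

section Independence
open Filter Topology

variable {Ω : Type*} [MeasurableSpace Ω] {P : Measure Ω}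

/-- Functions that depend on disjoint (possibly infinite) subfamilies of an independent family are
independent. -/
lemma indepFun_of_measurable_iSup {ι β γ : Type*} {κ : ι → Type*} [∀ i, MeasurableSpace (κ i)]
    [MeasurableSpace β] [MeasurableSpace γ] {f : ∀ i, Ω → κ i} (hf : iIndepFun f P)
    (hm : ∀ i, Measurable (f i)) {S T : Set ι} (hST : Disjoint S T) {g : Ω → β} {h : Ω → γ}
    (hg : Measurable[⨆ i ∈ S, MeasurableSpace.comap (f i) inferInstance] g)
    (hh : Measurable[⨆ i ∈ T, MeasurableSpace.comap (f i) inferInstance] h) :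
    IndepFun g h P :=
  indep_of_indep_of_le_left (indep_of_indep_of_le_right
    (indep_iSup_of_disjoint (fun i => (hm i).comap_le) hf.iIndep hST) hh.comap_le) hg.comap_le

variable [IsProbabilityMeasure P]

/-- Tonelli for the product law, with both integrals pulled back to the original sample space. -/
lemma lintegral_comp_prodMk_of_indepFun {β γ : Type*} [MeasurableSpace β] [MeasurableSpace γ]
    {V : Ω → β} {W : Ω → γ} (hV : Measurable V) (hW : Measurable W) (h : IndepFun V W P)
    {g : β → γ → ℝ≥0∞} (hg : Measurable (Function.uncurry g)) :
    ∫⁻ ω, g (V ω) (W ω) ∂P = ∫⁻ ω, ∫⁻ ω', g (V ω') (W ω) ∂P ∂P := by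
  have hp := (indepFun_iff_map_prod_eq_prod_map_map hV.aemeasurable hW.aemeasurable).1 h
  have h1 : ∫⁻ ω, g (V ω) (W ω) ∂P = ∫⁻ z, Function.uncurry g z ∂(P.map fun ω => (V ω, W ω)) := by
    rw [lintegral_map hg (hV.prodMk hW)]; rfl
  have := Measure.isProbabilityMeasure_map (μ := P) hV.aemeasurable
  have := Measure.isProbabilityMeasure_map (μ := P) hW.aemeasurable
  rw [h1, hp, lintegral_prod_symm' _ hg,
    lintegral_map (f := fun y => ∫⁻ x, Function.uncurry g (x, y) ∂(P.map V))
      hg.lintegral_prod_left' hW]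
  refine lintegral_congr fun ω => ?_
  rw [lintegral_map (f := fun x => Function.uncurry g (x, W ω)) (hg.comp measurable_prodMk_right) hV]
  rfl

/-- Integrating out a countable family of marks, given everything else. -/
lemma lintegral_mul_negExp_tsum_marks {ι 𝒰 𝒱 : Type*} [Countable ι] [MeasurableSpace 𝒰]
    [MeasurableSpace 𝒱] {U : Ω → 𝒰} {V : ι → Ω → 𝒱} (hU : Measurable U) (hV : ∀ i, Measurable (V i))
    (hind : ∀ (i : ι) (s : Set ι), i ∉ s →
      IndepFun (V i) (fun ω => (U ω, fun j : s => V j ω)) P)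
    {T : ι → 𝒰 → 𝒱 → ℝ≥0∞} (hT : ∀ i, Measurable (Function.uncurry (T i)))
    {κ : ι → 𝒰 → ℝ≥0∞} (hκ : ∀ i, Measurable (κ i))
    (hTκ : ∀ i u, ∫⁻ ω, negExp (T i u (V i ω)) ∂P = negExp (κ i u))
    {Φ : 𝒰 → ℝ≥0∞} (hΦ : Measurable Φ) (hΦ1 : ∀ u, Φ u ≤ 1) :
    ∫⁻ ω, Φ (U ω) * negExp (∑' i, T i (U ω) (V i ω)) ∂P =
      ∫⁻ ω, Φ (U ω) * negExp (∑' i, κ i (U ω)) ∂P := by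
  classical
  -- `Φ` is quantified inside the induction: once the mark of `a` is averaged, its factor depends on
  -- `U` alone and is absorbed into `Φ`.
  have hfin : ∀ (s : Finset ι) (Φ : 𝒰 → ℝ≥0∞), Measurable Φ →
      ∫⁻ ω, Φ (U ω) * negExp (∑ i ∈ s, T i (U ω) (V i ω)) ∂P =
      ∫⁻ ω, Φ (U ω) * negExp (∑ i ∈ s, κ i (U ω)) ∂P := by
    intro s
    induction s using Finset.induction_on with
    | empty => intro Φ _; simp
    | insert a s ha ih =>
      intro Φ hΦ
      simp_rw [Finset.sum_insert ha, negExp_add, ← mul_assoc]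
      rw [← ih (fun u => Φ u * negExp (κ a u)) (hΦ.mul (measurable_negExp.comp (hκ a)))]
      have hm : Measurable (fun ω => (U ω, fun j : (s : Set ι) => V j ω)) :=
        hU.prodMk (measurable_pi_lambda _ fun j => hV j)
      have h1 := lintegral_comp_prodMk_of_indepFun (hV a) hm (hind a s (by simpa using ha))
        (g := fun v w => Φ w.1 * negExp (T a w.1 v) *
          negExp (∑ i : (s : Set ι), T i w.1 (w.2 i))) (by
            have m1 : Measurable fun z : 𝒱 × 𝒰 × (↥(s : Set ι) → 𝒱) => z.2.1 :=
              measurable_fst.comp measurable_snd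
            refine Measurable.mul (Measurable.mul (hΦ.comp m1) ?_) ?_
            · exact measurable_negExp.comp ((hT a).comp (m1.prodMk measurable_fst))
            · refine measurable_negExp.comp (Finset.measurable_sum _ fun i _ => ?_)
              exact (hT i).comp (m1.prodMk ((measurable_pi_apply i).comp
                (measurable_snd.comp measurable_snd))))
      have h2 : ∀ ω, ∑ i : (s : Set ι), T i (U ω) (V i ω) = ∑ i ∈ s, T i (U ω) (V i ω) := fun ω =>
        Finset.sum_coe_sort s (fun i => T i (U ω) (V i ω))
      simp only [h2] at h1
      refine h1.trans (lintegral_congr fun ω => ?_)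
      have h3 : Measurable fun ω' => negExp (T a (U ω) (V a ω')) :=
        measurable_negExp.comp ((hT a).comp (measurable_const.prodMk (hV a)))
      rw [lintegral_mul_const _ (h3.const_mul _), lintegral_const_mul _ h3, hTκ]
  have hlim : ∀ g : ι → Ω → ℝ≥0∞, (∀ i, Measurable (g i)) →
      Tendsto (fun s : Finset ι => ∫⁻ ω, Φ (U ω) * negExp (∑ i ∈ s, g i ω) ∂P) atTop
        (𝓝 (∫⁻ ω, Φ (U ω) * negExp (∑' i, g i ω) ∂P)) := by
    intro g hg
    refine tendsto_lintegral_filter_of_dominated_convergence (fun _ => 1)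
      (Eventually.of_forall fun s => ?_) (Eventually.of_forall fun s => ae_of_all _ fun ω => ?_)
      (by simp) (ae_of_all _ fun ω => ?_)
    · exact (hΦ.comp hU).mul (measurable_negExp.comp (Finset.measurable_sum _ fun i _ => hg i))
    · exact mul_le_one' (hΦ1 _) (negExp_le_one _)
    · refine ENNReal.Tendsto.const_mul ?_ (Or.inr ((hΦ1 _).trans_lt ENNReal.one_lt_top).ne)
      exact (continuous_negExp.tendsto _).comp ENNReal.summable.hasSum
  refine tendsto_nhds_unique (hlim (fun i ω => T i (U ω) (V i ω))
    fun i => (hT i).comp (hU.prodMk (hV i))) ?_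
  simp_rw [hfin _ Φ hΦ]
  exact hlim (fun i ω => κ i (U ω)) fun i => (hκ i).comp hU

/-- Laplace transform of a thinned exponential variable. -/
lemma lintegral_negExp_ite {h : Ω → ℝ} {b : Ω → Bool} (hh : Measurable h) (hb : Measurable b)
    (hlaw : HasLaw h (expMeasure 1) P) {p : ℝ≥0∞} (hp : P {ω | b ω = true} = p)
    (hind : IndepFun h b P) (a : ℝ≥0∞) :
    ∫⁻ ω, negExp (if b ω = true then ENNReal.ofReal (h ω) * a else 0) ∂P = thinLaplace p a := by
  rw [lintegral_comp_prodMk_of_indepFun hh hb hind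
    (g := fun x y => negExp (if y = true then ENNReal.ofReal x * a else 0))
    (measurable_negExp.comp (Measurable.ite (measurableSet_eq_fun measurable_snd measurable_const)
      (by fun_prop) measurable_const))]
  have hset : MeasurableSet {ω | b ω = true} := hb (measurableSet_singleton true)
  have hE : ∫⁻ ω, negExp (ENNReal.ofReal (h ω) * a) ∂P = (1 + a)⁻¹ := by
    rw [← lintegral_negExp_expMeasure a]
    exact hlaw.lintegral_comp (f := fun x => negExp (ENNReal.ofReal x * a))
      (by fun_prop : Measurable fun x : ℝ => negExp (ENNReal.ofReal x * a)).aemeasurable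
  have hpt : ∀ ω, ∫⁻ ω', negExp (if b ω = true then ENNReal.ofReal (h ω') * a else 0) ∂P =
      {ω | b ω = true}ᶜ.indicator 1 ω + {ω | b ω = true}.indicator (fun _ => (1 + a)⁻¹) ω := by
    intro ω
    by_cases hω : b ω = true
    · simp [hω, hE]
    · simp [hω]
  simp_rw [hpt]
  rw [lintegral_add_right _ (measurable_const.indicator hset), lintegral_indicator_one hset.compl,
    lintegral_indicator_const hset, prob_compl_eq_one_sub hset, hp, thinLaplace, mul_comm]

end Independence
-- Independence of locations and marks in the network.
namespace Network

variable {Ω : Type*} {N : ℕ}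

/-- Locations of all transmitters. -/
def locations (net : Network Ω N) (ω : Ω) : (ℕ → Plane) × (ℕ → Plane) :=
  (fun k => net.mbs k ω, fun k => net.fap k ω)

/-- Fading coefficient of a transmitter, and whether it transmits on channel `c`. -/
def mark (net : Network Ω N) (c : Fin N) : ℕ ⊕ ℕ → Ω → ℝ × Bool
  | .inl m => fun ω => (net.mbsFading m ω, net.mbsActive m ω)
  | .inr m => fun ω => (net.fapFading m ω, decide (net.fapChannel m ω = c))

/-- Sources of randomness of the mark of a transmitter. -/
def markSources : ℕ ⊕ ℕ → Set Source
  | .inl m => {.mbsFading m, .mbsActivity m}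
  | .inr m => {.fapFading m, .fapChannel m}

section Independence

/-- The information in a set of sources of randomness. -/
@[reducible] def information (net : Network Ω N) (S : Set Source) : MeasurableSpace Ω :=
  ⨆ s ∈ S, MeasurableSpace.comap (net.element s) inferInstance

lemma measurable_element_information (net : Network Ω N) {S : Set Source} {s : Source}
    (hs : s ∈ S) : Measurable[net.information S] (net.element s) :=
  measurable_iff_comap_le.2
    (le_iSup₂ (f := fun s (_ : s ∈ S) => MeasurableSpace.comap (net.element s) inferInstance) s hs)

lemma measurable_locations_information (net : Network Ω N) {S : Set Source}
    (h1 : .mbsLocations ∈ S) (h2 : .fapLocations ∈ S) :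
    Measurable[net.information S] net.locations :=
  Measurable.prodMk (m := net.information S)
    (measurable_element_information net h1) (measurable_element_information net h2)

lemma measurable_mark_information (net : Network Ω N) (c : Fin N) {S : Set Source} {i : ℕ ⊕ ℕ}
    (h : markSources i ⊆ S) : Measurable[net.information S] (net.mark c i) := by
  cases i with
  | inl m =>
    exact Measurable.prodMk (m := net.information S)
      (measurable_element_information net (h (Set.mem_insert _ _)))
      (measurable_element_information net (h (Set.mem_insert_of_mem _ rfl)))
  | inr m =>
    have h2 : Measurable[net.information S] (net.fapChannel m) :=
      measurable_element_information net (h (Set.mem_insert_of_mem _ rfl))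
    exact Measurable.prodMk (m := net.information S)
      (measurable_element_information net (h (Set.mem_insert _ _)))
      ((Measurable.of_discrete (f := fun k : Fin N => decide (k = c))).comp h2)

lemma disjoint_markSources {i j : ℕ ⊕ ℕ} (h : j ≠ i) : markSources j ⊆ (markSources i)ᶜ := by
  intro s hs hs'
  rcases i with m | m <;> rcases j with k | k <;>
    rcases hs with rfl | rfl <;> rcases hs' with h' | h' <;> simp_all [Source.mbsFading.injEq]

variable [MeasurableSpace Ω] {P : Measure Ω} {net : Network Ω N} {lamB lamF zeta : ℝ}

lemma IsCoChannel.measurable_element (h : net.IsCoChannel P lamB lamF zeta) (s : Source) :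
    Measurable (net.element s) := by
  cases s with
  | mbsLocations => exact measurable_pi_lambda _ h.mbs_poisson.measurable
  | fapLocations => exact measurable_pi_lambda _ h.fap_poisson.measurable
  | mbsFading n => exact h.mbsFading_measurable n
  | fapFading n => exact h.fapFading_measurable n
  | mbsActivity n => exact h.mbsActive_measurable n
  | fapChannel n => exact h.fapChannel_measurable n

lemma IsCoChannel.indepFun_of_information (h : net.IsCoChannel P lamB lamF zeta)
    {S T : Set Source} (hST : Disjoint S T) {β γ : Type*} [MeasurableSpace β] [MeasurableSpace γ]
    {f : Ω → β} {g : Ω → γ} (hf : Measurable[net.information S] f)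
    (hg : Measurable[net.information T] g) : IndepFun f g P :=
  indepFun_of_measurable_iSup h.indep h.measurable_element hST hf hg

lemma IsCoChannel.information_le (h : net.IsCoChannel P lamB lamF zeta) (S : Set Source) :
    net.information S ≤ ‹MeasurableSpace Ω› :=
  iSup₂_le fun s _ => (h.measurable_element s).comap_le

lemma IsCoChannel.measurable_mark (h : net.IsCoChannel P lamB lamF zeta) (c : Fin N)
    (i : ℕ ⊕ ℕ) : Measurable (net.mark c i) :=
  (measurable_mark_information net c (Set.subset_univ _)).mono (h.information_le _) le_rfl

lemma IsCoChannel.measurable_locations (h : net.IsCoChannel P lamB lamF zeta) :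
    Measurable net.locations :=
  (measurable_locations_information net (S := Set.univ) trivial trivial).mono
    (h.information_le _) le_rfl

lemma IsCoChannel.indepFun_mark (h : net.IsCoChannel P lamB lamF zeta) (c : Fin N)
    {ι : Type*} (e : ι → ℕ ⊕ ℕ) {i : ℕ ⊕ ℕ} (hi : ∀ j, e j ≠ i) :
    IndepFun (net.mark c i) (fun ω => (net.locations ω, fun j => net.mark c (e j) ω)) P := by
  refine h.indepFun_of_information (disjoint_compl_right (a := markSources i))
    (measurable_mark_information net c subset_rfl)
    (Measurable.prodMk (m := net.information _)
      (measurable_locations_information net ?_ ?_) ?_)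
  · rcases i with m | m <;> simp [markSources]
  · rcases i with m | m <;> simp [markSources]
  · exact @measurable_pi_lambda _ _ _ (net.information _) _ _ fun j =>
      measurable_mark_information net c (disjoint_markSources (hi j))

/-- Here the serving fading alone is split off: the load involves the locations and the marks of all
other transmitters. -/
lemma IsCoChannel.indepFun_mbsFading (h : net.IsCoChannel P lamB lamF zeta) (c : Fin N) (n : ℕ) :
    IndepFun (net.mbsFading n)
      (fun ω => (net.locations ω, fun j : {j : ℕ ⊕ ℕ // j ≠ .inl n} => net.mark c j ω)) P := by
  have hf : Measurable[net.information {Source.mbsFading n}] (net.mbsFading n) :=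
    measurable_element_information net (s := .mbsFading n) rfl
  refine h.indepFun_of_information (disjoint_compl_right (a := {Source.mbsFading n})) hf
    (Measurable.prodMk (m := net.information _)
      (measurable_locations_information net ?_ ?_) ?_)
  · simp
  · simp
  · refine @measurable_pi_lambda _ _ _ (net.information _) _ _ fun j =>
      measurable_mark_information net c ?_
    obtain ⟨j, hj⟩ := j
    intro s hs
    rcases j with m | m <;> rcases hs with rfl | rfl <;> simp_all

lemma IsCoChannel.indepFun_locations (h : net.IsCoChannel P lamB lamF zeta) :
    IndepFun (fun ω k => net.fap k ω) (fun ω k => net.mbs k ω) P :=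
  h.indep.indepFun (i := .fapLocations) (j := .mbsLocations) (by simp)

/-- Probability that a transmitter transmits on the channel of the user. -/
noncomputable def activity (N : ℕ) (zeta : ℝ) : ℕ ⊕ ℕ → ℝ
  | .inl _ => zeta
  | .inr _ => 1 / N

lemma IsCoChannel.lintegral_mark [IsProbabilityMeasure P] (h : net.IsCoChannel P lamB lamF zeta)
    (c : Fin N) (i : ℕ ⊕ ℕ) (a : ℝ≥0∞) :
    ∫⁻ ω, negExp (if (net.mark c i ω).2 = true then ENNReal.ofReal (net.mark c i ω).1 * a else 0) ∂P =
      thinLaplace (ENNReal.ofReal (activity N zeta i)) a := by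
  cases i with
  | inl m =>
    exact lintegral_negExp_ite (h.mbsFading_measurable m) (h.mbsActive_measurable m)
      (h.mbsFading_law m) (h.mbsActive_law m)
      (h.indep.indepFun (i := .mbsFading m) (j := .mbsActivity m) (by simp)) a
  | inr m =>
    have hN : (0 : ℝ) < N := by exact_mod_cast c.pos
    have hp : P {ω | decide (net.fapChannel m ω = c) = true} =
        ENNReal.ofReal (activity N zeta (.inr m)) := by
      simp only [decide_eq_true_eq, activity, h.fapChannel_law m c, one_div]
      rw [ENNReal.ofReal_inv_of_pos hN, ENNReal.ofReal_natCast]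
    have hd : Measurable (fun k : Fin N => decide (k = c)) := .of_discrete
    exact lintegral_negExp_ite (h.fapFading_measurable m) (hd.comp (h.fapChannel_measurable m))
      (h.fapFading_law m) hp
      ((h.indep.indepFun (i := .fapFading m) (j := .fapChannel m) (by simp)).comp
        measurable_id hd) a

end Independence

end Network
-- From coverage to a sum of `palmTerm`.
namespace Network

variable {Ω : Type*} {N : ℕ}

/-- Configurations in which the other points are further away than the `n`-th one by a factor of at
least `R⁻¹`. -/
def isolated (R : ℝ) (n : ℕ) : Set (ℕ → Plane) :=
  {x | ∀ m, m ≠ n → ¬ ‖x m‖ < R⁻¹ * ‖x n‖}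

lemma measurableSet_isolated (R : ℝ) (n : ℕ) : MeasurableSet (isolated R n) := by
  have : isolated R n = ⋂ m, ⋂ (_ : m ≠ n), {x | ‖x m‖ < R⁻¹ * ‖x n‖}ᶜ := by
    ext x; simp [isolated]
  rw [this]
  exact MeasurableSet.iInter fun m => MeasurableSet.iInter fun _ =>
    (measurableSet_lt (by fun_prop) (by fun_prop)).compl

/-- Mean power received from a transmitter, times the threshold `β`, relative to the mean power
received from the `n`-th MBS. -/
noncomputable def linkGain (α β ρ : ℝ) (n : ℕ) : ℕ ⊕ ℕ → (ℕ → Plane) × (ℕ → Plane) → ℝ≥0∞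
  | .inl m => fun u => ENNReal.ofReal β * ENNReal.ofReal ‖u.1 n‖ ^ α * ‖u.1 m‖ₑ ^ (-α)
  | .inr m => fun u => ENNReal.ofReal (β * ρ) * ENNReal.ofReal ‖u.1 n‖ ^ α * ‖u.2 m‖ₑ ^ (-α)

lemma measurable_linkGain (α β ρ : ℝ) (n : ℕ) (j : ℕ ⊕ ℕ) : Measurable (linkGain α β ρ n j) := by
  cases j <;> unfold linkGain <;> fun_prop

/-- Fading level that the `n`-th MBS has to exceed in order to cover the user. -/
noncomputable def load (net : Network Ω N) (c : Fin N) (α β ρ : ℝ) (n : ℕ) (ω : Ω) : ℝ≥0∞ :=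
  ∑' j : {j : ℕ ⊕ ℕ // j ≠ .inl n}, if (net.mark c j ω).2 = true then
    ENNReal.ofReal (net.mark c j ω).1 * linkGain α β ρ n j (net.locations ω) else 0

lemma tsum_ne_inl (f : ℕ ⊕ ℕ → ℝ≥0∞) (n : ℕ) :
    ∑' j : {j : ℕ ⊕ ℕ // j ≠ .inl n}, f j =
      (∑' m, if m ≠ n then f (.inl m) else 0) + ∑' m, f (.inr m) := by
  have h : ∑' j : {j : ℕ ⊕ ℕ // j ≠ .inl n}, f j =
      ∑' j, {j : ℕ ⊕ ℕ | j ≠ .inl n}.indicator f j := tsum_subtype {j : ℕ ⊕ ℕ | j ≠ .inl n} f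
  rw [h, Summable.tsum_sum ENNReal.summable ENNReal.summable]
  congr 1 <;> refine tsum_congr fun m => ?_
  · by_cases h : m = n <;> simp [h]
  · simp

/-- Clearing denominators isolates the serving fading on one side, ready for its exponential
survival function. -/
lemma lt_sir_iff (net : Network Ω N) (c : Fin N) {PB PF α β : ℝ} (hβ : 0 < β) {n : ℕ} {ω : Ω}
    (hα : 0 < α) (hn : net.mbs n ω ≠ 0) :
    ENNReal.ofReal β < net.sir PB PF α c n ω ↔
      net.load c α β (PF / PB) n ω < ENNReal.ofReal (net.mbsFading n ω) := by
  have hβ0 : ENNReal.ofReal β ≠ 0 := by simpa using hβ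
  have hx0 : ‖net.mbs n ω‖ₑ ^ α ≠ 0 := by
    simp [ENNReal.rpow_eq_zero_iff, hn, enorm_ne_top]
  have hx1 : ‖net.mbs n ω‖ₑ ^ α ≠ ∞ := ENNReal.rpow_ne_top_of_nonneg hα.le enorm_ne_top
  -- Zero or infinite interference needs no separate case, because the threshold is neither zero nor
  -- infinite.
  rw [sir, ENNReal.lt_div_iff_mul_lt (Or.inr ENNReal.ofReal_ne_top) (Or.inr hβ0),
    ENNReal.rpow_neg, ← div_eq_mul_inv, ENNReal.lt_div_iff_mul_lt (Or.inl hx0) (Or.inl hx1)]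
  suffices h : ENNReal.ofReal β * (net.mbsInterference α n ω + net.fapInterference PB PF α c ω) *
      ‖net.mbs n ω‖ₑ ^ α = net.load c α β (PF / PB) n ω by rw [h]
  rw [load, tsum_ne_inl (fun j => if (net.mark c j ω).2 = true then
    ENNReal.ofReal (net.mark c j ω).1 * linkGain α β (PF / PB) n j (net.locations ω) else 0),
    mul_add, add_mul, mbsInterference, fapInterference, ← ENNReal.tsum_mul_left,
    ← ENNReal.tsum_mul_right, ← ENNReal.tsum_mul_left, ← ENNReal.tsum_mul_right]
  congr 1 <;> refine tsum_congr fun m => ?_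
  · simp only [mark, linkGain, locations, ofReal_norm]
    by_cases h1 : m = n
    · simp [h1]
    · by_cases h2 : net.mbsActive m ω = true
      · simp only [ne_eq, h1, not_false_eq_true, h2, and_self, if_true]
        ring
      · simp [h2]
  · simp only [mark, linkGain, locations, ofReal_norm, decide_eq_true_eq]
    by_cases h2 : net.fapChannel m ω = c
    · simp only [h2, if_true]
      rw [ENNReal.ofReal_mul hβ.le]
      ring
    · simp [h2]

section Coverage

variable [MeasurableSpace Ω] {P : Measure Ω} [IsProbabilityMeasure P] {net : Network Ω N}
  {lamB lamF zeta : ℝ}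

/-- Integral over the plane of the conditional probability that an FAP spoils a link of unit
length, per channel. -/
noncomputable def fapRate (α b : ℝ) (N : ℕ) : ℝ :=
  Real.pi * (0 ^ 2 + 1 / N * (b ^ (2 / α) *
    ∫ u in Set.Ioi (0 ^ 2 * b ^ (-(2 / α))), 1 / (1 + u ^ (α / 2))))

/-- An MBS inside the exclusion disc contributes the exponent `∞` and so kills the product, exactly
as the indicator does. The FAPs have no exclusion disc, whence the parameter `0`. -/
lemma indicator_isolated_mul_negExp (α β ρ R : ℝ) (n : ℕ) (u : (ℕ → Plane) × (ℕ → Plane)) :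
    (isolated R n).indicator 1 u.1 * negExp (∑' j : {j : ℕ ⊕ ℕ // j ≠ .inl n},
      negLog (thinLaplace (ENNReal.ofReal (activity N zeta j)) (linkGain α β ρ n j u))) =
    negExp (∑' m, if m ≠ n then
        linkExponent α β R⁻¹ (ENNReal.ofReal zeta) ‖u.1 n‖ (u.1 m) else 0) *
      negExp (∑' m, linkExponent α (β * ρ) 0 (ENNReal.ofReal (1 / N)) ‖u.1 n‖ (u.2 m)) := by
  rw [tsum_ne_inl (fun j => negLog (thinLaplace (ENNReal.ofReal (activity N zeta j))
    (linkGain α β ρ n j u))), negExp_add, ← mul_assoc]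
  congr 1
  · by_cases h : u.1 ∈ isolated R n
    · rw [Set.indicator_of_mem h, Pi.one_apply, one_mul]
      congr 1
      refine tsum_congr fun m => ?_
      by_cases hm : m = n
      · simp [hm]
      · rw [if_pos hm, if_pos hm, linkExponent, if_neg (h m hm)]
        rfl
    · rw [Set.indicator_of_notMem h, zero_mul]
      obtain ⟨m, hm, hlt⟩ : ∃ m, m ≠ n ∧ ‖u.1 m‖ < R⁻¹ * ‖u.1 n‖ := by
        simpa [isolated] using h
      rw [ENNReal.tsum_eq_top_of_eq_top ⟨m, by rw [if_pos hm, linkExponent, if_pos hlt]⟩,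
        negExp_top]
  · congr 1
    refine tsum_congr fun m => ?_
    have : ¬ ‖u.2 m‖ < 0 * ‖u.1 n‖ := by simp
    rw [linkExponent, if_neg this]
    rfl

omit [IsProbabilityMeasure P] in
lemma lintegral_ite_lt_ofReal {h : Ω → ℝ} (hh : Measurable h) (hlaw : HasLaw h (expMeasure 1) P)
    (s : ℝ≥0∞) : ∫⁻ ω, (if s < ENNReal.ofReal (h ω) then 1 else 0) ∂P = negExp s := by
  have hm : MeasurableSet {x : ℝ | s < ENNReal.ofReal x} :=
    measurableSet_lt measurable_const (by fun_prop)
  have hm' : MeasurableSet {ω | s < ENNReal.ofReal (h ω)} := hh hm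
  rw [← expMeasure_survival, ← hlaw.measure_eq hm, ← lintegral_indicator_one hm']
  refine lintegral_congr fun ω => ?_
  by_cases hω : s < ENNReal.ofReal (h ω) <;> simp [hω]

/-- The fading coefficient of the serving link is integrated out. -/
lemma IsCoChannel.lintegral_mul_ite_load_lt (h : net.IsCoChannel P lamB lamF zeta)
    (c : Fin N) (α β ρ : ℝ) (n : ℕ) {Φ : (ℕ → Plane) × (ℕ → Plane) → ℝ≥0∞} (hΦ : Measurable Φ) :
    ∫⁻ ω, Φ (net.locations ω) *
        (if net.load c α β ρ n ω < ENNReal.ofReal (net.mbsFading n ω) then 1 else 0) ∂P =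
      ∫⁻ ω, Φ (net.locations ω) * negExp (net.load c α β ρ n ω) ∂P := by
  let S : ((ℕ → Plane) × (ℕ → Plane)) × ({j : ℕ ⊕ ℕ // j ≠ .inl n} → ℝ × Bool) → ℝ≥0∞ :=
    fun w => ∑' j, if (w.2 j).2 = true then
      ENNReal.ofReal (w.2 j).1 * linkGain α β ρ n j w.1 else 0
  have hS : Measurable S := by
    refine Measurable.tsum fun j => ?_
    have hj : Measurable fun w : ((ℕ → Plane) × (ℕ → Plane)) ×
        ({j : ℕ ⊕ ℕ // j ≠ .inl n} → ℝ × Bool) => w.2 j :=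
      (measurable_pi_apply j).comp measurable_snd
    exact Measurable.ite (measurableSet_eq_fun hj.snd measurable_const)
      (hj.fst.ennreal_ofReal.mul ((measurable_linkGain α β ρ n j).comp measurable_fst))
      measurable_const
  have hW : Measurable (fun ω => (net.locations ω,
      fun j : {j : ℕ ⊕ ℕ // j ≠ .inl n} => net.mark c j ω)) :=
    h.measurable_locations.prodMk (measurable_pi_lambda _ fun j => h.measurable_mark c j)
  have key := lintegral_comp_prodMk_of_indepFun (h.mbsFading_measurable n) hW
    (h.indepFun_mbsFading c n)
    (g := fun x w => Φ w.1 * (if S w < ENNReal.ofReal x then 1 else 0))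
    (Measurable.mul (hΦ.comp (measurable_fst.comp measurable_snd))
      (Measurable.ite (measurableSet_lt (hS.comp measurable_snd) (by fun_prop))
        measurable_const measurable_const))
  refine key.trans (lintegral_congr fun ω => ?_)
  rw [lintegral_const_mul, lintegral_ite_lt_ofReal (h.mbsFading_measurable n) (h.mbsFading_law n)]
  · rfl
  · exact Measurable.ite (measurableSet_lt measurable_const
      (h.mbsFading_measurable n).ennreal_ofReal) measurable_const measurable_const

lemma IsCoChannel.activity_le_one (h : net.IsCoChannel P lamB lamF zeta) (c : Fin N)
    (i : ℕ ⊕ ℕ) : ENNReal.ofReal (activity N zeta i) ≤ 1 := by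
  obtain i | i := i
  · simp only [activity]
    rw [← h.mbsActive_law 0]
    exact prob_le_one
  · rw [ENNReal.ofReal_le_one, activity]
    have hN : (0 : ℝ) < N := by exact_mod_cast c.pos
    rw [div_le_one hN]; exact_mod_cast c.pos

/-- The marks of the interfering transmitters are integrated out. -/
lemma IsCoChannel.lintegral_mul_negExp_load (h : net.IsCoChannel P lamB lamF zeta)
    (c : Fin N) (α β ρ : ℝ) (n : ℕ) {Φ : (ℕ → Plane) × (ℕ → Plane) → ℝ≥0∞} (hΦ : Measurable Φ)
    (hΦ1 : ∀ u, Φ u ≤ 1) :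
    ∫⁻ ω, Φ (net.locations ω) * negExp (net.load c α β ρ n ω) ∂P =
      ∫⁻ ω, Φ (net.locations ω) * negExp (∑' j : {j : ℕ ⊕ ℕ // j ≠ .inl n},
        negLog (thinLaplace (ENNReal.ofReal (activity N zeta j))
          (linkGain α β ρ n j (net.locations ω)))) ∂P :=
  lintegral_mul_negExp_tsum_marks (ι := {j : ℕ ⊕ ℕ // j ≠ .inl n})
    (V := fun j => net.mark c j) h.measurable_locations (fun j => h.measurable_mark c j)
    (fun i s hi => h.indepFun_mark c (fun j : s => j.1.1)
      (fun j hj => hi (by rw [← Subtype.ext hj]; exact j.2)))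
    (T := fun j u v => if v.2 = true then ENNReal.ofReal v.1 * linkGain α β ρ n j u else 0)
    (fun j => Measurable.ite
      (measurableSet_eq_fun (measurable_snd.comp measurable_snd) measurable_const)
      (Measurable.mul (by fun_prop) ((measurable_linkGain α β ρ n j).comp measurable_fst))
      measurable_const)
    (κ := fun j u => negLog (thinLaplace (ENNReal.ofReal (activity N zeta j))
      (linkGain α β ρ n j u)))
    (fun j => measurable_negLog.comp ((measurable_thinLaplace _).comp
      (measurable_linkGain α β ρ n j)))
    (fun j u => by
      rw [negExp_negLog (thinLaplace_le_one (h.activity_le_one c j) _)]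
      exact h.lintegral_mark c j _) hΦ hΦ1

/-- The locations of the FAPs are integrated out. -/
lemma IsCoChannel.lintegral_mul_negExp_tsum_fap (h : net.IsCoChannel P lamB lamF zeta)
    (hlamF : 0 ≤ lamF) (n : ℕ) {Ψ : (ℕ → Plane) → ℝ≥0∞} (hΨ : Measurable Ψ)
    {ψ : ℝ → Plane → ℝ≥0∞} (hψ : Measurable (Function.uncurry ψ)) :
    ∫⁻ ω, Ψ (fun k => net.mbs k ω) * negExp (∑' m, ψ ‖net.mbs n ω‖ (net.fap m ω)) ∂P =
      ∫⁻ ω, Ψ (fun k => net.mbs k ω) *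
        negExp (ENNReal.ofReal lamF * ∫⁻ y, (1 - negExp (ψ ‖net.mbs n ω‖ y))) ∂P := by
  have hmX : Measurable (fun ω k => net.mbs k ω) :=
    measurable_pi_lambda _ h.mbs_poisson.measurable
  have hmY : Measurable (fun ω k => net.fap k ω) :=
    measurable_pi_lambda _ h.fap_poisson.measurable
  have hm : Measurable fun z : (ℕ → Plane) × (ℕ → Plane) => negExp (∑' m, ψ ‖z.2 n‖ (z.1 m)) := by
    refine measurable_negExp.comp (Measurable.tsum fun m => ?_)
    have h1 : Measurable fun z : (ℕ → Plane) × (ℕ → Plane) => ‖z.2 n‖ :=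
      ((measurable_pi_apply n).comp measurable_snd).norm
    have h2 : Measurable fun z : (ℕ → Plane) × (ℕ → Plane) => z.1 m :=
      (measurable_pi_apply m).comp measurable_fst
    exact hψ.comp (h1.prodMk h2)
  have key := lintegral_comp_prodMk_of_indepFun hmY hmX h.indepFun_locations
    (g := fun y x => Ψ x * negExp (∑' m, ψ ‖x n‖ (y m))) ((hΨ.comp measurable_snd).mul hm)
  refine key.trans (lintegral_congr fun ω => ?_)
  -- The plain Laplace functional is the case of the empty set and of a constant function of its
  -- count.
  have hlap := h.fap_poisson.lintegral_mul_negExp_tsum hlamF (φ := ψ ‖net.mbs n ω‖)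
    (hψ.comp measurable_prodMk_left) MeasurableSet.empty (by simp) (F := fun _ => 1) (by simp)
  simp only [one_mul, lintegral_const, measure_univ] at hlap
  have hmω : Measurable fun ω' => negExp (∑' m, ψ ‖net.mbs n ω‖ (net.fap m ω')) :=
    measurable_negExp.comp (Measurable.tsum fun m =>
      (hψ.comp measurable_prodMk_left).comp (h.fap_poisson.measurable m))
  rw [lintegral_const_mul _ hmω, hlap]

/-- The FAP field acts on a link only through a factor Gaussian in its length, which becomes the `γ`
of `palmTerm`. -/
lemma IsCoChannel.lintegral_mul_negExp_fap (h : net.IsCoChannel P lamB lamF zeta)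
    (hlamF : 0 ≤ lamF) (hN : 0 < N) {α b : ℝ} (hα : 2 < α) (hb : 0 < b) (n : ℕ)
    {Ψ : (ℕ → Plane) → ℝ≥0∞} (hΨ : Measurable Ψ) :
    ∫⁻ ω, Ψ (fun k => net.mbs k ω) * negExp (∑' m,
        linkExponent α b 0 (ENNReal.ofReal (1 / N)) ‖net.mbs n ω‖ (net.fap m ω)) ∂P =
      ∫⁻ ω, Ψ (fun k => net.mbs k ω) *
        negExp (ENNReal.ofReal (lamF * fapRate α b N * ‖net.mbs n ω‖ ^ 2)) ∂P := by
  rw [h.lintegral_mul_negExp_tsum_fap hlamF n hΨ (measurable_linkExponent _ _ _ _)]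
  refine lintegral_congr fun ω => ?_
  have hN' : (0 : ℝ) < N := by exact_mod_cast hN
  have hN1 : (1 : ℝ) / N ∈ Set.Icc (0 : ℝ) 1 :=
    ⟨by positivity, by rw [div_le_one hN']; exact_mod_cast hN⟩
  rw [lintegral_one_sub_negExp_linkExponent hα hb le_rfl hN1 (norm_nonneg _),
    ← ENNReal.ofReal_mul hlamF, fapRate, mul_assoc lamF]

/-- Probability that the `n`-th MBS is closer than all others by the factor `R` and covers the
user. -/
lemma IsCoChannel.lintegral_isolated_mul_covered (h : net.IsCoChannel P lamB lamF zeta)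
    (hlamF : 0 ≤ lamF) (c : Fin N) {α β ρ : ℝ} (hα : 2 < α) (hβ : 0 < β) (hρ : 0 < ρ)
    (R : ℝ) (n : ℕ) :
    ∫⁻ ω, (isolated R n).indicator 1 (fun k => net.mbs k ω) *
        (if net.load c α β ρ n ω < ENNReal.ofReal (net.mbsFading n ω) then 1 else 0) ∂P =
      ∫⁻ ω, palmTerm (linkExponent α β R⁻¹ (ENNReal.ofReal zeta))
        (lamF * fapRate α (β * ρ) N) (fun k => net.mbs k ω) n ∂P := by
  have hΦ : Measurable fun u : (ℕ → Plane) × (ℕ → Plane) =>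
      (isolated R n).indicator (1 : (ℕ → Plane) → ℝ≥0∞) u.1 :=
    (measurable_one.indicator (measurableSet_isolated R n)).comp measurable_fst
  refine (h.lintegral_mul_ite_load_lt c α β ρ n hΦ).trans ?_
  rw [h.lintegral_mul_negExp_load c α β ρ n hΦ
    (fun u => Set.indicator_le_self' (fun _ _ => zero_le_one) _)]
  simp_rw [indicator_isolated_mul_negExp]
  refine h.lintegral_mul_negExp_fap hlamF c.pos hα (mul_pos hβ hρ) n
    (Ψ := fun x => negExp (∑' m, if m ≠ n then
      linkExponent α β R⁻¹ (ENNReal.ofReal zeta) ‖x n‖ (x m) else 0)) ?_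
  refine measurable_negExp.comp (Measurable.tsum fun m => ?_)
  split_ifs
  · exact measurable_linkExponent_comp _ _ _ _ (measurable_pi_apply n).norm (measurable_pi_apply m)
  · exact measurable_const

end Coverage

end Network

/-- With activity zero only the exclusion disc remains, so the probability of being a CCU is an
instance of the same sum. -/
lemma palmTerm_linkExponent_zero (α β R : ℝ) (x : ℕ → Plane) (n : ℕ) :
    palmTerm (linkExponent α β R⁻¹ (ENNReal.ofReal 0)) 0 x n =
      (Network.isolated R n).indicator 1 x := by
  have hthin : ∀ a, thinLaplace 0 a = 1 := fun a => by simp [thinLaplace]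
  rw [palmTerm, zero_mul, ENNReal.ofReal_zero, negExp_zero, mul_one]
  by_cases h : x ∈ Network.isolated R n
  · rw [Set.indicator_of_mem h, Pi.one_apply, ← negExp_zero]
    congr 1
    refine ENNReal.tsum_eq_zero.2 fun m => ?_
    split_ifs with hm
    · rw [linkExponent, if_neg (h m hm), hthin, negLog_one]
    · rfl
  · rw [Set.indicator_of_notMem h]
    obtain ⟨m, hm, hlt⟩ : ∃ m, m ≠ n ∧ ‖x m‖ < R⁻¹ * ‖x n‖ := by
      simpa [Network.isolated] using h
    rw [ENNReal.tsum_eq_top_of_eq_top ⟨m, by rw [if_pos hm, linkExponent, if_pos hlt]⟩,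
      negExp_top]

/-! ### Almost sure properties of the configuration of points. -/

section Configurations

variable {Ω : Type*} [MeasurableSpace Ω] {P : Measure Ω} [IsProbabilityMeasure P]
  {X : ℕ → Ω → Plane} {lam : ℝ}

omit [IsProbabilityMeasure P] in
lemma IsPoissonProcess.ae_count_closedBall_ne_top (hX : IsPoissonProcess P X lam) (hlam : 0 ≤ lam) :
    ∀ᵐ ω ∂P, ∀ r : ℕ, count (fun n => X n ω) (Metric.closedBall 0 r) ≠ ⊤ := by
  rw [ae_all_iff]
  intro r
  have hB : MeasurableSet (Metric.closedBall (0 : Plane) r) :=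
    Metric.isClosed_closedBall.measurableSet
  have hv : volume (Metric.closedBall (0 : Plane) r) ≠ ∞ := measure_closedBall_lt_top.ne
  have := ae_lt_top (hX.measurable_count hB) (by
    rw [hX.lintegral_count hlam hB hv]
    exact ENNReal.mul_ne_top ENNReal.ofReal_ne_top hv)
  filter_upwards [this] with ω hω h
  rw [h] at hω
  simp at hω

omit [IsProbabilityMeasure P] in
lemma IsPoissonProcess.ae_ne_zero (hX : IsPoissonProcess P X lam) (hlam : 0 ≤ lam) :
    ∀ᵐ ω ∂P, ∀ n, X n ω ≠ 0 := by
  have hB : MeasurableSet ({0} : Set Plane) := measurableSet_singleton _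
  have h := hX.lintegral_count hlam hB (by simp)
  rw [measure_singleton, mul_zero, lintegral_eq_zero_iff (hX.measurable_count hB)] at h
  filter_upwards [h] with ω hω n hn
  have h0 : count (fun n => X n ω) {0} = 0 := by simpa using hω
  have : n ∈ {n | X n ω ∈ ({0} : Set Plane)} := hn
  rw [count, Set.encard_eq_zero] at h0
  rw [h0] at this
  exact this

lemma IsPoissonProcess.lintegral_tsum_isolated (hX : IsPoissonProcess P X lam) (hlam : 0 < lam)
    {R : ℝ} (hR : 0 < R) :
    ∫⁻ ω, ∑' n, (Network.isolated R n).indicator 1 (fun k => X k ω) ∂P = ENNReal.ofReal (R ^ 2) := by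
  have h := hX.lintegral_tsum_palmTerm hlam
    -- The values `3` and `1` for the path loss exponent and the threshold are arbitrary: activity
    -- zero makes them irrelevant.
    (measurable_linkExponent 3 1 R⁻¹ (ENNReal.ofReal 0))
    (fun s t y _ hst => linkExponent_mono (by norm_num) (by positivity) _ y hst)
    (by rw [zero_mul, add_zero]; positivity : 0 < Real.pi * (R⁻¹ ^ 2 + 0 * ((1 : ℝ) ^ (2 / 3 : ℝ) *
      ∫ u in Set.Ioi (R⁻¹ ^ 2 * (1 : ℝ) ^ (-(2 / 3 : ℝ))), 1 / (1 + u ^ (3 / 2 : ℝ)))))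
    le_rfl
    (fun t ht => lintegral_one_sub_negExp_linkExponent (by norm_num) one_pos (by positivity)
      ⟨le_rfl, zero_le_one⟩ ht)
  simp only [palmTerm_linkExponent_zero] at h
  rw [h]
  congr 1
  field_simp
  simp

/-- A ball that contains one point of the subfamily contains finitely many points, among which the
minimum is attained. -/
lemma exists_min_norm_ne {x : ℕ → Plane}
    (hx : ∀ r : ℕ, count x (Metric.closedBall 0 r) ≠ ⊤) (s : Set ℕ) (hs : s.Nonempty) :
    ∃ n ∈ s, ∀ m ∈ s, ‖x n‖ ≤ ‖x m‖ := by
  obtain ⟨k, hk⟩ := hs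
  obtain ⟨r, hr⟩ := exists_nat_gt ‖x k‖
  have hfin : {n | x n ∈ Metric.closedBall (0 : Plane) r}.Finite :=
    Set.encard_ne_top_iff.1 (hx r)
  obtain ⟨n, hn, hmin⟩ := Set.exists_min_image ({n | x n ∈ Metric.closedBall (0 : Plane) r} ∩ s)
    (fun n => ‖x n‖) (hfin.inter_of_left s) ⟨k, by simpa using hr.le, hk⟩
  refine ⟨n, hn.2, fun m hm => ?_⟩
  by_cases h : ‖x m‖ ≤ r
  · exact hmin m ⟨by simpa using h, hm⟩
  · have : ‖x n‖ ≤ r := by simpa using hn.1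
    exact this.trans (not_le.1 h).le

lemma mem_isolated_one_iff {x : ℕ → Plane} {n : ℕ} :
    x ∈ Network.isolated 1 n ↔ ∀ m, ‖x n‖ ≤ ‖x m‖ := by
  simp only [Network.isolated, inv_one, one_mul, not_lt, Set.mem_ofPred_eq]
  refine ⟨fun h m => ?_, fun h m _ => h m⟩
  by_cases hm : m = n
  · rw [hm]
  · exact h m hm

/-- Almost surely exactly one point is closest to the origin. -/
lemma IsPoissonProcess.ae_existsUnique_isolated (hX : IsPoissonProcess P X lam) (hlam : 0 < lam) :
    ∀ᵐ ω ∂P, ∃! n, (fun k => X k ω) ∈ Network.isolated 1 n := by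
  set f : Ω → ℝ≥0∞ := fun ω =>
    ∑' n, (Network.isolated 1 n).indicator 1 (fun k => X k ω) with hf
  have hex : ∀ᵐ ω ∂P, ∃ n, (fun k => X k ω) ∈ Network.isolated 1 n := by
    filter_upwards [hX.ae_count_closedBall_ne_top hlam.le] with ω hω
    obtain ⟨n, -, hn⟩ := exists_min_norm_ne hω Set.univ ⟨0, trivial⟩
    exact ⟨n, mem_isolated_one_iff.2 fun m => hn m trivial⟩
  have hge : (fun _ => 1) ≤ᵐ[P] f := by
    filter_upwards [hex] with ω ⟨n, hn⟩
    refine le_trans ?_ (ENNReal.le_tsum n)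
    rw [Set.indicator_of_mem hn]
    rfl
  have hfm : Measurable f := Measurable.tsum fun n =>
    (measurable_one.indicator (Network.measurableSet_isolated 1 n)).comp
      (measurable_pi_lambda _ hX.measurable)
  -- The number of closest points is almost surely at least one and has mean one, hence equals one
  -- almost surely; ties need no direct estimate.
  have heq := ae_eq_of_ae_le_of_lintegral_le hge (by simp) hfm.aemeasurable (by
    rw [hX.lintegral_tsum_isolated hlam one_pos]; simp)
  filter_upwards [hex, heq] with ω ⟨n, hn⟩ h1
  refine ⟨n, hn, fun m hm => ?_⟩
  by_contra hne
  have h2 := ENNReal.sum_le_tsum (f := fun n =>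
    (Network.isolated 1 n).indicator (1 : (ℕ → Plane) → ℝ≥0∞) (fun k => X k ω)) {m, n}
  rw [Finset.sum_pair hne, Set.indicator_of_mem hm, Set.indicator_of_mem hn] at h2
  have h3 : (1 : ℝ≥0∞) + 1 ≤ 1 := h2.trans_eq h1.symm
  norm_num at h3

end Configurations

/-- The network events have convenient descriptions only off a null set; this yields their
null-measurability together with their probability. -/
lemma measure_eq_lintegral_of_indicator_ae_eq {Ω : Type*} [MeasurableSpace Ω] {P : Measure Ω}
    {A : Set Ω} {f : Ω → ℝ≥0∞} (hf : Measurable f) (h : A.indicator 1 =ᵐ[P] f) :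
    NullMeasurableSet A P ∧ P A = ∫⁻ ω, f ω ∂P := by
  have hA : NullMeasurableSet A P := by
    refine ⟨f ⁻¹' {1}, hf (measurableSet_singleton 1), ?_⟩
    refine Filter.eventuallyEq_set.2 ?_
    filter_upwards [h] with ω hω
    rw [Set.mem_preimage, Set.mem_singleton_iff, ← hω]
    by_cases hA : ω ∈ A <;> simp [hA]
  exact ⟨hA, by rw [← lintegral_congr_ae h, lintegral_indicator_one₀ hA]⟩

/-! ### The cell-center event and the coverage probability. -/

namespace Network

variable {Ω : Type*} {N : ℕ}

lemma isServing_iff (net : Network Ω N) {PB α : ℝ} (hPB : 0 < PB) (hα : 0 < α) {n : ℕ} {ω : Ω} :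
    net.IsServing PB α n ω ↔ (fun k => net.mbs k ω) ∈ isolated 1 n := by
  have h0 : ENNReal.ofReal PB ≠ 0 := by simpa using hPB
  rw [mem_isolated_one_iff, IsServing]
  refine forall_congr' fun m => ?_
  rw [ENNReal.mul_le_mul_iff_right h0 ENNReal.ofReal_ne_top, ENNReal.rpow_neg, ENNReal.rpow_neg,
    ENNReal.inv_le_inv, ENNReal.rpow_le_rpow_iff hα, enorm_le_iff_norm_le]

lemma mbsDistance_one (net : Network Ω N) {ω : Ω} {n : ℕ}
    (hn : (fun k => net.mbs k ω) ∈ isolated 1 n) : net.mbsDistance 1 ω = ‖net.mbs n ω‖ := by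
  have hmin := mem_isolated_one_iff.1 hn
  have : {r : ℝ | ((1 : ℕ) : ℕ∞) ≤ count (fun n => net.mbs n ω) (Metric.closedBall 0 r)} =
      Set.Ici ‖net.mbs n ω‖ := by
    ext r
    simp only [Set.mem_ofPred_eq, Set.mem_Ici, Nat.cast_one, count, Set.one_le_encard_iff_nonempty]
    constructor
    · rintro ⟨m, hm⟩
      exact (hmin m).trans (by simpa using hm)
    · intro h
      exact ⟨n, by simpa using h⟩
  rw [mbsDistance, this, csInf_Ici]

lemma mbsDistance_two (net : Network Ω N) {ω : Ω} {n k : ℕ}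
    (hn : (fun k => net.mbs k ω) ∈ isolated 1 n) (hk : k ≠ n)
    (hmin' : ∀ m, m ≠ n → ‖net.mbs k ω‖ ≤ ‖net.mbs m ω‖) :
    net.mbsDistance 2 ω = ‖net.mbs k ω‖ := by
  have hmin := mem_isolated_one_iff.1 hn
  have : {r : ℝ | ((2 : ℕ) : ℕ∞) ≤ count (fun n => net.mbs n ω) (Metric.closedBall 0 r)} =
      Set.Ici ‖net.mbs k ω‖ := by
    ext r
    have h2 : ((2 : ℕ) : ℕ∞) = 1 + 1 := by norm_num
    rw [Set.mem_ofPred_eq, h2, ENat.add_one_le_iff (by simp), count, Set.one_lt_encard_iff]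
    constructor
    · rintro ⟨a, b, ha, hb, hab⟩
      have ha' : ‖net.mbs a ω‖ ≤ r := by simpa using ha
      have hb' : ‖net.mbs b ω‖ ≤ r := by simpa using hb
      by_cases h : a = n
      · exact (hmin' b (by rw [← h]; exact hab.symm)).trans hb'
      · exact (hmin' a h).trans ha'
    · intro h
      have h' : ‖net.mbs k ω‖ ≤ r := h
      exact ⟨k, n, by simpa using h', by simpa using (hmin k).trans h', hk⟩
  rw [mbsDistance, this, csInf_Ici]

/-- The second distance is the least norm among the other MBSs, so a bound on the ratio is a bound
for all of them at once. Nonzero locations keep the division meaningful. -/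
lemma mem_cellCenter_iff (net : Network Ω N) {R : ℝ} (hR : 0 < R) {ω : Ω}
    (hfin : ∀ r : ℕ, count (fun k => net.mbs k ω) (Metric.closedBall 0 r) ≠ ⊤)
    (hne : ∀ n, net.mbs n ω ≠ 0) {n : ℕ} (hn : (fun k => net.mbs k ω) ∈ isolated 1 n) :
    ω ∈ net.cellCenter R ↔ (fun k => net.mbs k ω) ∈ isolated R n := by
  obtain ⟨k, hk, hmin'⟩ := exists_min_norm_ne hfin {m | m ≠ n} ⟨n + 1, Nat.succ_ne_self n⟩
  rw [cellCenter, Set.mem_ofPred_eq, net.mbsDistance_one hn, net.mbsDistance_two hn hk hmin',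
    div_le_iff₀ (norm_pos_iff.2 (hne k)), ← inv_mul_le_iff₀ hR]
  simp only [isolated, Set.mem_ofPred_eq, not_lt]
  exact ⟨fun h m hm => h.trans (hmin' m hm), fun h => h k hk⟩

lemma isolated_subset_isolated_one {R : ℝ} (hR : 0 < R) (hR1 : R ≤ 1) (n : ℕ) :
    isolated R n ⊆ isolated 1 n := fun x hx m hm h =>
  hx m hm (h.trans_le (by gcongr))

section Coverage

variable [MeasurableSpace Ω] {P : Measure Ω} [IsProbabilityMeasure P] {net : Network Ω N}
  {lamB lamF zeta : ℝ}

omit [IsProbabilityMeasure P] in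
lemma IsCoChannel.measurable_load (h : net.IsCoChannel P lamB lamF zeta) (c : Fin N)
    (α β ρ : ℝ) (n : ℕ) : Measurable (net.load c α β ρ n) := by
  refine Measurable.tsum fun j => ?_
  have hj := h.measurable_mark c j
  exact Measurable.ite (measurableSet_eq_fun hj.snd measurable_const)
    (hj.fst.ennreal_ofReal.mul ((measurable_linkGain α β ρ n j).comp h.measurable_locations))
    measurable_const

/-- As `R ≤ 1`, an isolated MBS is the closest one, so the sum of the indicators over all MBSs has
at most one nonzero term almost surely and equals the indicator of the event. -/
lemma IsCoChannel.measure_cellCenter (h : net.IsCoChannel P lamB lamF zeta) (hlamB : 0 < lamB)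
    {R : ℝ} (hR : 0 < R) (hR1 : R ≤ 1) :
    NullMeasurableSet (net.cellCenter R) P ∧
      P (net.cellCenter R) = ENNReal.ofReal (R ^ 2) := by
  rw [← h.mbs_poisson.lintegral_tsum_isolated hlamB hR]
  refine measure_eq_lintegral_of_indicator_ae_eq (Measurable.tsum fun n =>
    (measurable_one.indicator (measurableSet_isolated R n)).comp
      (measurable_pi_lambda _ h.mbs_poisson.measurable)) ?_
  filter_upwards [h.mbs_poisson.ae_count_closedBall_ne_top hlamB.le,
    h.mbs_poisson.ae_ne_zero hlamB.le, h.mbs_poisson.ae_existsUnique_isolated hlamB]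
    with ω h1 h2 ⟨n, hn, huniq⟩
  have hiff := net.mem_cellCenter_iff hR h1 h2 hn
  rw [tsum_eq_single n fun m hm => Set.indicator_of_notMem
    (fun hm' => hm (huniq m (isolated_subset_isolated_one hR hR1 m hm'))) _]
  by_cases hc : ω ∈ net.cellCenter R
  · rw [Set.indicator_of_mem hc, Set.indicator_of_mem (hiff.1 hc)]
    rfl
  · rw [Set.indicator_of_notMem hc, Set.indicator_of_notMem (mt hiff.2 hc)]

lemma IsCoChannel.measure_covered_inter_cellCenter (h : net.IsCoChannel P lamB lamF zeta)
    (hlamB : 0 < lamB) {PB PF α β R : ℝ} (hPB : 0 < PB) (hα : 0 < α) (hβ : 0 < β) (hR : 0 < R)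
    (hR1 : R ≤ 1) (c : Fin N) :
    P (net.covered PB PF α β c ∩ net.cellCenter R) =
      ∑' n, ∫⁻ ω, (isolated R n).indicator 1 (fun k => net.mbs k ω) *
        (if net.load c α β (PF / PB) n ω < ENNReal.ofReal (net.mbsFading n ω) then 1 else 0) ∂P := by
  have hm : ∀ n, Measurable fun ω => (isolated R n).indicator 1 (fun k => net.mbs k ω) *
      (if net.load c α β (PF / PB) n ω < ENNReal.ofReal (net.mbsFading n ω)
        then (1 : ℝ≥0∞) else 0) := fun n =>
    ((measurable_one.indicator (measurableSet_isolated R n)).comp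
      (measurable_pi_lambda _ h.mbs_poisson.measurable)).mul
    (Measurable.ite (measurableSet_lt (h.measurable_load c α β (PF / PB) n)
      (h.mbsFading_measurable n).ennreal_ofReal) measurable_const measurable_const)
  rw [← lintegral_tsum fun n => (hm n).aemeasurable]
  refine (measure_eq_lintegral_of_indicator_ae_eq (Measurable.tsum hm) ?_).2
  filter_upwards [h.mbs_poisson.ae_count_closedBall_ne_top hlamB.le,
    h.mbs_poisson.ae_ne_zero hlamB.le, h.mbs_poisson.ae_existsUnique_isolated hlamB]
    with ω h1 h2 ⟨n, hn, huniq⟩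
  have hiff := net.mem_cellCenter_iff hR h1 h2 hn
  have hcov : ω ∈ net.covered PB PF α β c ↔
      net.load c α β (PF / PB) n ω < ENNReal.ofReal (net.mbsFading n ω) := by
    rw [← net.lt_sir_iff c hβ hα (h2 n)]
    constructor
    · rintro ⟨m, hm, hlt⟩
      rwa [huniq m ((net.isServing_iff hPB hα).1 hm)] at hlt
    · exact fun hlt => ⟨n, (net.isServing_iff hPB hα).2 hn, hlt⟩
  rw [tsum_eq_single n fun m hm => by
    rw [Set.indicator_of_notMem
      (fun hm' => hm (huniq m (isolated_subset_isolated_one hR hR1 m hm'))), zero_mul]]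
  by_cases hc : ω ∈ net.cellCenter R <;> by_cases hb : ω ∈ net.covered PB PF α β c
  · rw [Set.indicator_of_mem (Set.mem_inter hb hc), Set.indicator_of_mem (hiff.1 hc), if_pos (hcov.1 hb)]
    simp
  · rw [Set.indicator_of_notMem (fun h => hb h.1), if_neg (mt hcov.2 hb), mul_zero]
  · rw [Set.indicator_of_notMem (fun h => hc h.2), Set.indicator_of_notMem (mt hiff.2 hc),
      zero_mul]
  · rw [Set.indicator_of_notMem (fun h => hb h.1), if_neg (mt hcov.2 hb), mul_zero]

/-- Coverage probability of a cell-center user, in terms of the integrals over the plane. -/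
lemma IsCoChannel.ccuCoverage_eq (h : net.IsCoChannel P lamB lamF zeta)
    (hlamB : 0 < lamB) (hlamF : 0 ≤ lamF) (hzeta : zeta ∈ Set.Icc (0 : ℝ) 1)
    {PB PF α β R : ℝ} (hPB : 0 < PB) (hPF : 0 < PF) (hα : 2 < α) (hβ : 0 < β)
    (hR : 0 < R) (hR1 : R ≤ 1) (c : Fin N) :
    net.ccuCoverage P PB PF α R β c = (R ^ 2 * (R⁻¹ ^ 2 + zeta * (β ^ (2 / α) *
      (∫ u in Set.Ioi (R⁻¹ ^ 2 * β ^ (-(2 / α))), 1 / (1 + u ^ (α / 2)))) +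
      lamF * fapRate α (β * (PF / PB)) N / (Real.pi * lamB)))⁻¹ := by
  obtain ⟨hnull, hcc⟩ := h.measure_cellCenter hlamB hR hR1
  have hJ : ∀ A : ℝ, 0 ≤ A → 0 ≤ ∫ u in Set.Ioi A, 1 / (1 + u ^ (α / 2)) := fun A hA =>
    setIntegral_nonneg measurableSet_Ioi fun u hu => by
      have := Real.rpow_nonneg (hA.trans (le_of_lt hu)) (α / 2)
      positivity
  have hJ1 := hJ (R⁻¹ ^ 2 * β ^ (-(2 / α))) (by positivity)
  have hρ : 0 < PF / PB := by positivity
  have hJ2 := hJ (0 ^ 2 * (β * (PF / PB)) ^ (-(2 / α))) (by positivity)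
  have hz := hzeta.1
  have hγ : 0 ≤ lamF * fapRate α (β * (PF / PB)) N := by
    unfold fapRate
    positivity
  have hpalm := h.mbs_poisson.lintegral_tsum_palmTerm hlamB
    (measurable_linkExponent α β R⁻¹ (ENNReal.ofReal zeta))
    (fun s t y _ hst => linkExponent_mono (by linarith) (by positivity) _ y hst)
    (by positivity : 0 < Real.pi * (R⁻¹ ^ 2 + zeta * (β ^ (2 / α) *
      ∫ u in Set.Ioi (R⁻¹ ^ 2 * β ^ (-(2 / α))), 1 / (1 + u ^ (α / 2)))))
    hγ (fun t ht => lintegral_one_sub_negExp_linkExponent hα hβ (by positivity) hzeta ht)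
  rw [lintegral_tsum fun n => (measurable_palmTerm h.mbs_poisson.measurable
    (measurable_linkExponent _ _ _ _) _ n).aemeasurable] at hpalm
  have hcov := h.measure_covered_inter_cellCenter hlamB (PF := PF) hPB (by linarith : 0 < α) hβ hR
    hR1 c
  simp_rw [h.lintegral_isolated_mul_covered hlamF c hα hβ hρ R] at hcov
  rw [hpalm, mul_div_cancel_left₀ _ Real.pi_ne_zero] at hcov
  -- The quotient of the two probabilities; null-measurability of the conditioning event suffices to
  -- evaluate the restricted measure.
  rw [ccuCoverage, ProbabilityTheory.cond, measureReal_def, Measure.smul_apply,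
    Measure.restrict_apply₀' hnull, hcov, hcc, smul_eq_mul, ENNReal.toReal_mul, ENNReal.toReal_inv,
    ENNReal.toReal_ofReal (by positivity), ENNReal.toReal_ofReal (by positivity), mul_inv]

end Coverage

end Network
end HetNet

theorem corollary1 {Ω : Type*} [MeasurableSpace Ω] (P : Measure Ω) [IsProbabilityMeasure P]
    (N : ℕ) (net : HetNet.Network Ω N) (lamB lamF zetaC PB PF α δ R β : ℝ)
    (hlamB : 0 < lamB) (hlamF : 0 < lamF) (hzeta : zetaC ∈ Set.Icc (0 : ℝ) 1)
    (hPB : 0 < PB) (hPF : 0 < PF) (hα : 2 < α) (hδ : δ = 2 / α)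
    (hR : 0 < R) (hR1 : R ≤ 1) (hβ : 0 < β)
    (hnet : net.IsCoChannel P lamB lamF zetaC) (c : Fin N) :
    net.ccuCoverage P PB PF α R β c =
        (1 + zetaC * R ^ 2 * HetNet.H β δ R +
          Real.pi * δ * R ^ 2 * ((lamF / N) / lamB) * (β * (PF / PB)) ^ δ *
            (1 / Real.sin (Real.pi * δ)))⁻¹ ∧
      IntegrableOn (fun u : ℝ => 1 / (1 + u ^ (1 / δ)))
        (Set.Ioi (R ^ (-2 : ℤ) * β ^ (-δ))) ∧
      HetNet.H β (1 / 2) R = β ^ (1 / 2 : ℝ) * Real.arctan (R ^ 2 * β ^ (1 / 2 : ℝ)) := by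
  have hδ0 : 0 < δ := by rw [hδ]; positivity
  have hδ1 : δ < 1 := by rw [hδ, div_lt_one (by linarith)]; exact hα
  have hinv : α / 2 = 1 / δ := by rw [hδ, one_div_div]
  refine ⟨?_, HetNet.integrableOn_one_div_one_add_rpow
    (by rw [lt_div_iff₀ hδ0]; linarith) (by positivity), HetNet.H_half hβ hR⟩
  have hN : (0 : ℝ) < N := by exact_mod_cast c.pos
  have hR2 : R⁻¹ ^ 2 = R ^ (-2 : ℤ) := by rw [inv_pow, zpow_neg]; rfl
  have hH : HetNet.H β δ R = β ^ δ *
      ∫ u in Set.Ioi (R⁻¹ ^ 2 * β ^ (-δ)), 1 / (1 + u ^ (1 / δ)) := by rw [HetNet.H, hR2]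
  rw [hnet.ccuCoverage_eq hlamB hlamF.le hzeta hPB hPF hα hβ hR hR1 c, HetNet.Network.fapRate,
    ← hδ, hinv, ← hH]
  -- Without an exclusion disc the FAP integral starts at zero, where it has the cosecant form.
  have h0 : (0 : ℝ) ^ 2 * (β * (PF / PB)) ^ (-δ) = 0 := by ring
  rw [h0, HetNet.integral_one_div_one_add_rpow hδ0 hδ1]
  congr 1
  have hpi := Real.pi_ne_zero
  set s := 1 / Real.sin (Real.pi * δ)
  field_simp
  ring
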